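/- **Conventions.** Strings and sequences are binary, and $S\upharpoonright n$ is the prefix of length $n$ of the sequence $S$. For strings $w,x$ let $\mathrm{occ}(w,x)$ be the number of strings $u$ such that $uw$ is a prefix of $x$. A sequence $S$ is normal if $\lim_{n\to\infty}\mathrm{occ}(w,S\upharpoonright n)/n=2^{-|w|}$ for every string $w$. For a map $T$ from strings to strings, $\rho_T(S)=\liminf_{n\to\infty}|T(S\upharpoonright n)|/n$ and $R_T(S)=\limsup_{n\to\infty}|T(S\upharpoonright n)|/n$. **The sequence.** A de Bruijn string of order $n\ge 1$ is a string of length $2^n$ which, read cyclically, contains every string of length $n$ exactly once; $db(n)$ is the lexicographically least one, and $db_i(n)$ is $db(n)$ shifted cyclically to the left by $i$ bits. For $n=2^st$ with $t$ odd let $S_n=B_{n,0}B_{n,1}\cdots B_{n,2^s-1}$, where $B_{n,i}$ is $db_i(n)$ concatenated with itself $t$ times. Let $S=S_1S_2S_3\cdots$. **PPM\* (without exclusion, with Method C escapes).** After a string $x$ has been read, the count of the bit $b$ in the context $w$ is $\mathrm{occ}(wb,x)$, and the count of the escape symbol in $w$ is the number of distinct bits $b$ with $\mathrm{occ}(wb,x)>0$.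 The contexts in the model are the strings $w$ that have been followed by at least one bit in $x$ and are either empty or of the form $w=vb$ with $b$ a bit and $\mathrm{occ}(v,x)\ge 2$. The relevant contexts are the suffixes of $x$ that are in the model. A context is deterministic if its escape count is $1$. The next bit is encoded starting in the shortest deterministic relevant context, or in the longest relevant context if none is deterministic. If the bit has a positive count in the current context, it is encoded there with probability its count divided by the sum of the counts of $0$, $1$ and the escape symbol. Otherwise an escape symbol is encoded, with probability given in the same way, and the next shorter relevant context becomes the current one. When no relevant context is left, the bit is encoded with probability $\tfrac12$. The arithmetic encoder starts with the interval $[0,1)$ and at each step passes to the subinterval belonging to the encoded symbol, where the current interval is divided in proportion to these probabilities. If $[a,b)$ is the final interval and $m=\lceil-\log_2(b-a)\rceil$, the output $\mathrm{PPM}^*(x)$ is the $m$-bit binary expansion of the least multiple of $2^{-m}$ in $[a,b)$. **Lempel–Ziv 78.** The string $x$ is parsed from left to right into phrases $x_1x_2\cdots x_k$, where each phrase is the shortest prefix of the remaining input which is different from $x_0,x_1,x_2,\dots$ so far ($x_0$ being the empty string), except that the last phrase may repeat an earlier one. With $x_i=x_{l(i)}b_i$, where $l(i)<i$ and $b_i$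 is a bit, the output is $LZ(x)=c_{l(1)}b_1c_{l(2)}b_2\cdots c_{l(k)}b_k$. Here $(c_i)_{i\ge 0}$ is a prefix-free code for the pointers with $|c_i|\le(1+o(1))\log_2 i$. **Theorem.** The sequence $S$ is normal, $R_{\mathrm{PPM}^*}(S)=0$, and $\rho_{LZ}(S)=1$ for every such choice of the code $(c_i)_{i\ge 0}$. In particular, there is a normal sequence with $R_{\mathrm{PPM}^*}(S)=0$ and $\rho_{LZ}(S)=1$. -/

import Mathlib

namespace PPMLZ

/-! Bits are `Bool` (`false` is 0, `true` is 1), finite strings are `List Bool`, infinite binary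
sequences are functions `ℕ → Bool`, indexed from 0. -/

/-- The prefix of length `n` of the infinite sequence `S`. -/
def pref (S : ℕ → Bool) (n : ℕ) : List Bool := (List.range n).map S

/-- The number of (possibly overlapping) occurrences of `w` as a substring of `x`, counted by
starting position. The empty string occurs `|x| + 1` times. -/
def occ (w x : List Bool) : ℕ :=
  ((Finset.range (x.length + 1)).filter fun i => w <+: x.drop i).card

/-- Borel normality to base 2. -/
def IsNormal (S : ℕ → Bool) : Prop :=
  ∀ w : List Bool, Filter.Tendsto (fun n : ℕ => (occ w (pref S n) : ℝ) / n) Filter.atTop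
    (nhds ((1 / 2 : ℝ) ^ w.length))

/-- The worst-case compression ratio of `T` on `S`, as an extended real number. -/
noncomputable def worstRatio (T : List Bool → List Bool) (S : ℕ → Bool) : EReal :=
  Filter.limsup (fun n : ℕ => ((((T (pref S n)).length : ℝ) / n : ℝ) : EReal)) Filter.atTop

/-- The best-case compression ratio of `T` on `S`, as an extended real number. -/
noncomputable def bestRatio (T : List Bool → List Bool) (S : ℕ → Bool) : EReal :=
  Filter.liminf (fun n : ℕ => ((((T (pref S n)).length : ℝ) / n : ℝ) : EReal)) Filter.atTop

/-! ### De Bruijn strings and the sequence -/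

/-- `x` is a de Bruijn string of order `n`: it has length `2 ^ n` and, read cyclically, contains
every string of length `n` exactly once. -/
def IsDeBruijn (n : ℕ) (x : List Bool) : Prop :=
  x.length = 2 ^ n ∧ ∀ w : List Bool, w.length = n → occ w (x ++ x.take (n - 1)) = 1

/-- The zone `S_n` built from a string `d`: for `n = 2 ^ s * t` with `t` odd, it is
`B_0 B_1 ⋯ B_(2 ^ s - 1)`, where `B_i` is the left cyclic shift of `d` by `i` bits, repeated
`t` times. -/
def zone (d : List Bool) (n : ℕ) : List Bool :=
  (List.range (2 ^ padicValNat 2 n)).flatMap fun i =>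
    (List.replicate (n / 2 ^ padicValNat 2 n) (d.rotate i)).flatten

/-- `S = S_1 S_2 S_3 ⋯`, where `S_n` is the zone built from `db n`. -/
def IsZoneSequence (db : ℕ → List Bool) (S : ℕ → Bool) : Prop :=
  ∀ N : ℕ, let p := (List.range N).flatMap fun k => zone (db (k + 1)) (k + 1)
    pref S p.length = p

/-! ### The compressor PPM*, without exclusion, with Method C escapes -/

/-- The frequency count of the prediction `b` in the context `w`, when `x` has been read. -/
def cnt (x w : List Bool) (b : Bool) : ℕ := occ (w ++ [b]) x

/-- The Method C frequency count of the escape symbol in the context `w`: the number of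
distinct bits that have followed `w`. -/
def esc (x w : List Bool) : ℕ :=
  (if 0 < cnt x w false then 1 else 0) + (if 0 < cnt x w true then 1 else 0)

/-- The sum of all frequency counts in the context `w`. -/
def total (x w : List Bool) : ℕ := cnt x w false + cnt x w true + esc x w

/-- `w` is a context of the model after `x` has been read. A substring `v` that has occurred at
least twice is extended to `v b` for every bit `b` that has followed it, and a context enters the
model once it predicts something. -/
def InModel (x w : List Bool) : Prop :=
  (w = [] ∨ 2 ≤ occ w.dropLast x) ∧ 0 < cnt x w false + cnt x w true

instance (x w : List Bool) : Decidable (InModel x w) := by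
  unfold InModel; infer_instance

/-- The relevant contexts: the suffixes of `x` that are in the model, the longest first. -/
def relevant (x : List Bool) : List (List Bool) := x.tails.filter fun w => InModel x w

/-- The contexts that are tried in turn to encode the next bit. The first one is the shortest
deterministic relevant context, or the longest relevant context if none is deterministic. After
an escape the next shorter relevant context is tried. -/
def chain (x : List Bool) : List (List Bool) :=
  match (relevant x).reverse.find? fun w => esc x w = 1 with
  | some w => (relevant x).filter fun v => v.length ≤ w.length
  | none => relevant x

/-- An interval `[a, a + d)` is stored as `(a, d)`. If it is cut into `tot` equal pieces, then
this is the union of the pieces with numbers `start, …, start + len - 1`. -/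
def cut (I : ℚ × ℚ) (start len tot : ℕ) : ℚ × ℚ :=
  (I.1 + I.2 * (start / tot), I.2 * (len / tot))

/-- The effect on the arithmetic coding interval of encoding the bit `b`, when `x` has been read
and the listed contexts are still to be tried. In each context the interval is divided
between `0`, `1` and the escape symbol, in this order, in proportion to their counts. When no
context is left, both bits have probability `1 / 2`. -/
def encodeIn (x : List Bool) (b : Bool) : List (List Bool) → ℚ × ℚ → ℚ × ℚ
  | [], I => cut I (if b then 1 else 0) 1 2
  | w :: ws, I =>
    if 0 < cnt x w b then
      cut I (if b then cnt x w false else 0) (cnt x w b) (total x w)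
    else
      encodeIn x b ws (cut I (cnt x w false + cnt x w true) (esc x w) (total x w))

/-- The final interval of the arithmetic encoder on input `x`. -/
def finalInterval (x : List Bool) : ℚ × ℚ :=
  (x.foldl (fun (p : List Bool × (ℚ × ℚ)) b => (p.1 ++ [b], encodeIn p.1 b (chain p.1) p.2))
    ([], ((0 : ℚ), (1 : ℚ)))).2

/-- The PPM* compressor. If `[a, a + d)` is the final interval and `m` is `- log₂ d`, rounded up,
then the output is the `m`-bit binary expansion of the least multiple `c` of `2 ^ (-m)` with
`a ≤ c`, and `c < a + d` since `2 ^ (-m) ≤ d`. -/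
def ppmStar (x : List Bool) : List Bool :=
  let I := finalInterval x
  let m := Nat.clog 2 ⌈I.2⁻¹⌉₊
  let c := ⌈I.1 * 2 ^ m⌉₊
  (List.range m).map fun i => c.testBit (m - 1 - i)

/-! ### The Lempel-Ziv 78 compressor -/

/-- Reading one bit. The state is the dictionary `x_0, x_1, …` with `x_0` empty, and the part of
the current phrase that has been read. -/
def lzStep (p : List (List Bool) × List Bool) (b : Bool) : List (List Bool) × List Bool :=
  if p.2 ++ [b] ∈ p.1 then (p.1, p.2 ++ [b]) else (p.1 ++ [p.2 ++ [b]], [])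

/-- The dictionary and the unfinished last phrase after `x` has been read. -/
def lzState (x : List Bool) : List (List Bool) × List Bool := x.foldl lzStep ([[]], [])

/-- The Lempel-Ziv 78 phrases of `x`; the last one may be a repetition of an earlier one. -/
def lzPhrases (x : List Bool) : List (List Bool) :=
  (lzState x).1.tail ++ (if (lzState x).2 = [] then [] else [(lzState x).2])

/-- The Lempel-Ziv 78 compressor with pointer code `c`: each phrase is encoded as the code of the
dictionary index of the phrase without its last bit, followed by this last bit. -/
def lz (c : ℕ → List Bool) (x : List Bool) : List Bool :=
  (lzPhrases x).flatMap fun p => c ((lzState x).1.idxOf p.dropLast) ++ [p.getLastD false]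

/-- `c` is a prefix-free code for the pointers `0, 1, 2, …`, and it is efficient: the code of `i`
has at most `(1 + o(1)) log₂ i` bits. -/
structure IsPointerCode (c : ℕ → List Bool) : Prop where
  prefixFree : ∀ i j : ℕ, c i <+: c j → i = j
  efficient : ∀ ε : ℝ, 0 < ε →
    ∀ᶠ i : ℕ in Filter.atTop, ((c i).length : ℝ) ≤ (1 + ε) * Real.logb 2 i

/-- Pointer codes exist: a binary expansion, preceded by its length in a self-delimiting form. -/
theorem exists_isPointerCode : ∃ c : ℕ → List Bool, IsPointerCode c := by
  have binj : ∀ m n : ℕ, m.bits = n.bits → m = n := fun m n h =>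
    Nat.eq_of_testBit_eq fun i => by rw [Nat.testBit_eq_inth, Nat.testBit_eq_inth, h]
  have unary : ∀ (k l : ℕ) (r s : List Bool), List.replicate k true ++ false :: r <+:
      List.replicate l true ++ false :: s → k = l ∧ r <+: s := by
    intro k
    induction k with
    | zero =>
      intro l r s h
      cases l with
      | zero => simpa using h
      | succ l => simp [List.replicate_succ] at h
    | succ k ih =>
      intro l r s h
      cases l with
      | zero => simp [List.replicate_succ] at h
      | succ l =>
        simp only [List.replicate_succ, List.cons_append, List.cons_prefix_cons, true_and] at h
        obtain ⟨h1, h2⟩ := ih l r s h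
        exact ⟨by rw [h1], h2⟩
  refine ⟨fun i => List.replicate (i + 1).bits.length.bits.length true ++
    false :: ((i + 1).bits.length.bits ++ (i + 1).bits), ⟨?_, ?_⟩⟩
  · intro i j h
    obtain ⟨h1, t, h2⟩ := unary _ _ _ _ h
    rw [List.append_assoc] at h2
    obtain ⟨h3, h4⟩ := List.append_inj h2 h1
    have h5 := binj _ _ h3
    have h6 := (List.append_inj (h4.trans (List.append_nil _).symm) h5).1
    have := binj _ _ h6
    omega
  · intro ε hε
    have sizeLe : ∀ n : ℕ, 0 < n → (n.size : ℝ) ≤ Real.logb 2 n + 1 := by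
      intro n hn
      obtain ⟨k, hk⟩ : ∃ k, n.size = k + 1 :=
        Nat.exists_eq_succ_of_ne_zero (Nat.size_pos.2 hn).ne'
      have h1 : 2 ^ k ≤ n := Nat.lt_size.1 (by omega)
      have h2 : (k : ℝ) ≤ Real.logb 2 n := by
        rw [Real.le_logb_iff_rpow_le (by norm_num) (by exact_mod_cast hn), Real.rpow_natCast]
        exact_mod_cast h1
      rw [hk]; push_cast; linarith
    have lo : ∀ δ : ℝ, 0 < δ → ∀ᶠ y : ℝ in Filter.atTop, Real.logb 2 y ≤ δ * y := by
      intro δ hδ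
      have hl : 0 < Real.log 2 := Real.log_pos (by norm_num)
      filter_upwards [Real.isLittleO_log_id_atTop.bound (mul_pos hδ hl), Filter.eventually_ge_atTop 1]
        with y hy hy1
      rw [Real.logb, div_le_iff₀ hl]
      have := (le_abs_self _).trans hy
      simp only [id, Real.norm_eq_abs, abs_of_nonneg (zero_le_one.trans hy1)] at this
      linarith
    have tl : Filter.Tendsto (fun i : ℕ => Real.logb 2 i) Filter.atTop Filter.atTop :=
      (Real.tendsto_logb_atTop (by norm_num)).comp tendsto_natCast_atTop_atTop
    have tl2 : Filter.Tendsto (fun i : ℕ => Real.logb 2 i + 2) Filter.atTop Filter.atTop :=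
      Filter.tendsto_atTop_add_const_right _ _ tl
    filter_upwards [tl2.eventually (lo (ε / 8) (by linarith)),
      tl.eventually (Filter.eventually_ge_atTop (20 / ε)), tl.eventually (Filter.eventually_ge_atTop 1),
      Filter.eventually_ge_atTop 1] with i h1 h2 h2' h3
    have hi : (1 : ℝ) ≤ i := by exact_mod_cast h3
    have e1 : ((i + 1).size : ℝ) ≤ Real.logb 2 i + 2 := by
      refine (sizeLe (i + 1) (by omega)).trans ?_
      have : Real.logb 2 ((i + 1 : ℕ) : ℝ) ≤ Real.logb 2 (2 * i) :=
        Real.logb_le_logb_of_le (by norm_num) (by positivity) (by push_cast; linarith)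
      rw [Real.logb_mul (by norm_num) (by linarith), Real.logb_self_eq_one (by norm_num)] at this
      linarith
    have p1 : 0 < (i + 1).size := Nat.size_pos.2 (by omega)
    have e2 : ((i + 1).size.size : ℝ) ≤ ε / 8 * (Real.logb 2 i + 2) + 1 := by
      refine (sizeLe _ p1).trans ?_
      have := Real.logb_le_logb_of_le (b := 2) (by norm_num)
        (show (0 : ℝ) < ((i + 1).size : ℝ) by exact_mod_cast p1) e1
      linarith
    have e3 : 20 ≤ ε * Real.logb 2 i := by
      rw [div_le_iff₀ hε] at h2; linarith
    simp only [List.length_append, List.length_replicate, List.length_cons, Nat.size_eq_bits_len]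
    push_cast
    nlinarith

end PPMLZ

namespace PPMLZ

open Finset

/-! Zone `n` reads a de Bruijn string of order `n` exactly `n` times, so it has `n * 2 ^ n` bits. An
error of `o(n * 2 ^ n)` in each zone is negligible in the average over the whole sequence, because a
zone is at most a constant factor longer than all that precedes it (`tendsto_average_zero`).

Normality. A string of length `l ≤ n` occurs `2 ^ (n - l)` times in a period, and at a copy boundary
the count changes by at most `l` (`card_win_eq`, `card_copy`).

Lempel–Ziv. Cut zone `n`, where `n = 2 ^ s * t` with `t` odd, into `2 ^ n` blocks of length `n`. The
part with rotation `q` consists of whole blocks, and its block `a` starts at position `q + a * n` of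
the periodic sequence. Modulo `2 ^ s` this is `q`, and what remains determines `a` because `t` is
odd. So the rotations make the blocks of zone `n` run through all strings of length `n`, each once
(`block_injOn`). Hence the phrases are exactly the blocks (`lzState_pref`): short strings are used
up before longer ones, and a phrase of zone `n` needs a pointer of about `n` bits. Few phrases can
have shorter pointers, since a phrase is determined by its pointer and last bit (`lz_lower_bound`).

PPM*. The output length is, up to 2 bits, at most the sum of the costs `-log₂ p` of the bits. Any
bit of zone `n` costs `O(log n)`: the context of length `n - 2` has been followed by both bits, so
there is at most one escape, and contexts that long have polynomially bounded counts
(`cost_le_maxCost`). In copy `j ≥ 1`, a context of length `L ≥ n` that is not right special is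
deterministic and has seen the correct bit in `j` earlier copies; the cost is at most `log₂ ((j + 1)
/ j)`, which telescopes over the copies to `log₂ n` (`cost_le_of_not_mem_rightSpecial`). Right
special windows are few: each one increases the number of windows by 1 when the length grows from
`L` to `L + 1`, and there are only `2 ^ (n + 1)` plus polynomially many windows of length `2 * n`.
So for some `L` between `n` and `2 * n` there are about `2 ^ (n + 1) / n` at most, each met at most
once per copy. Altogether zone `n` costs `O(2 ^ n * log n)`, which is `o(n * 2 ^ n)`. -/

/-! ### Windows of infinite sequences -/

/-- The window of length `l` of the sequence `f` that starts at position `k`. -/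
def win (f : ℕ → Bool) (k l : ℕ) : List Bool := (List.range l).map fun i => f (k + i)

@[simp] lemma length_win (f : ℕ → Bool) (k l : ℕ) : (win f k l).length = l := by simp [win]

@[simp] lemma win_zero (f : ℕ → Bool) (k : ℕ) : win f k 0 = [] := by simp [win]

lemma getElem_win (f : ℕ → Bool) (k l i : ℕ) (h : i < (win f k l).length) :
    (win f k l)[i] = f (k + i) := by simp [win]

lemma win_eq_win_iff {f g : ℕ → Bool} {k k' l : ℕ} :
    win f k l = win g k' l ↔ ∀ i < l, f (k + i) = g (k' + i) := by
  simp [win, List.map_inj_left]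

lemma win_eq_iff {f : ℕ → Bool} {k : ℕ} {w : List Bool} :
    win f k w.length = w ↔ ∀ (i : ℕ) (h : i < w.length), f (k + i) = w[i] := by
  constructor
  · intro h i hi
    have := getElem_win f k w.length i (by simpa using hi)
    simp only [h] at this
    exact this.symm
  · intro h
    refine List.ext_getElem (by simp) fun i h1 h2 => ?_
    rw [getElem_win, h i h2]

lemma win_add (f : ℕ → Bool) (k a b : ℕ) : win f k (a + b) = win f k a ++ win f (k + a) b := by
  simp [win, List.range_add, Function.comp_def, add_assoc]

lemma win_succ (f : ℕ → Bool) (k l : ℕ) : win f k (l + 1) = win f k l ++ [f (k + l)] := by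
  rw [win_add]; simp [win]

lemma pref_eq_win (S : ℕ → Bool) (n : ℕ) : pref S n = win S 0 n := by simp [pref, win]

@[simp] lemma length_pref (S : ℕ → Bool) (n : ℕ) : (pref S n).length = n := by simp [pref]

lemma pref_succ (S : ℕ → Bool) (n : ℕ) : pref S (n + 1) = pref S n ++ [S n] := by
  simp [pref_eq_win, win_succ]

lemma win_drop (f : ℕ → Bool) (k l i : ℕ) : (win f k l).drop i = win f (k + i) (l - i) := by
  rcases le_total i l with h | h
  · obtain ⟨m, rfl⟩ := Nat.exists_eq_add_of_le h
    rw [win_add, List.drop_left' (by simp)]; simp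
  · simp [List.drop_eq_nil_of_le, h, Nat.sub_eq_zero_of_le h]

lemma win_take (f : ℕ → Bool) (k : ℕ) {l i : ℕ} (h : i ≤ l) : (win f k l).take i = win f k i := by
  obtain ⟨m, rfl⟩ := Nat.exists_eq_add_of_le h
  rw [win_add, List.take_left' (by simp)]

lemma prefix_win_iff {f : ℕ → Bool} {k l : ℕ} {w : List Bool} :
    w <+: win f k l ↔ w.length ≤ l ∧ win f k w.length = w := by
  constructor
  · intro h
    have hl : w.length ≤ l := by simpa using h.length_le
    exact ⟨hl, by rw [← win_take f k hl]; exact (List.prefix_iff_eq_take.1 h).symm⟩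
  · rintro ⟨h1, h2⟩
    rw [← h2, ← win_take f k h1]
    exact List.take_prefix _ _

lemma occ_pref (w : List Bool) (S : ℕ → Bool) (m : ℕ) :
    occ w (pref S m) =
      ((range (m + 1)).filter fun i => i + w.length ≤ m ∧ win S i w.length = w).card := by
  unfold occ
  rw [length_pref]
  congr 1
  refine filter_congr fun i hi => ?_
  rw [pref_eq_win, win_drop, prefix_win_iff, zero_add]
  have := mem_range.1 hi
  refine and_congr_left fun _ => ?_
  omega

/-! ### Cyclic reading of de Bruijn strings -/

/-- The periodic sequence obtained by reading `d` cyclically. -/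
def cyc (d : List Bool) (k : ℕ) : Bool := d.getD (k % d.length) false

lemma cyc_add_length (d : List Bool) (k : ℕ) : cyc d (k + d.length) = cyc d k := by simp [cyc]

lemma win_cyc_self (d : List Bool) : win (cyc d) 0 d.length = d := by
  refine win_eq_iff.2 fun i h => ?_
  rw [zero_add, cyc, Nat.mod_eq_of_lt h, List.getD_eq_getElem _ _ h]

/-- Appending the first `n - 1` bits leaves exactly `2 ^ n` starting positions for strings of length
`n`, one for each position of the cycle. -/
lemma isDeBruijn_iff {n : ℕ} (hn : 1 ≤ n) {d : List Bool} :
    IsDeBruijn n d ↔ d.length = 2 ^ n ∧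
      ∀ w : List Bool, w.length = n → #{k ∈ range (2 ^ n) | win (cyc d) k n = w} = 1 := by
  unfold IsDeBruijn
  refine and_congr_right fun hd => forall₂_congr fun w hw => ?_
  have hlt : n < 2 ^ n := Nat.lt_two_pow_self
  have e : d ++ d.take (n - 1) = pref (cyc d) (2 ^ n + (n - 1)) := by
    rw [pref_eq_win, win_add, ← hd, win_cyc_self]
    congr 1
    conv_lhs => rw [← win_cyc_self d]
    rw [win_take _ _ (by omega)]
    refine win_eq_win_iff.2 fun i _ => ?_
    rw [zero_add, zero_add, add_comm, cyc_add_length]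
  rw [e, occ_pref, hw]
  have : {i ∈ range (2 ^ n + (n - 1) + 1) | i + n ≤ 2 ^ n + (n - 1) ∧ win (cyc d) i n = w} =
      {k ∈ range (2 ^ n) | win (cyc d) k n = w} := by
    ext i
    simp only [mem_filter, mem_range]
    constructor
    · rintro ⟨_, h2, h3⟩; exact ⟨by omega, h3⟩
    · rintro ⟨h1, h2⟩; exact ⟨by omega, by omega, h2⟩
  rw [this]

/-! ### The zone decomposition -/

/-- The position at which zone `n` starts. -/
def start (n : ℕ) : ℕ := ∑ k ∈ range n, k * 2 ^ k

lemma start_succ (n : ℕ) : start (n + 1) = start n + n * 2 ^ n := by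
  simp [start, sum_range_succ]

lemma start_mono : Monotone start :=
  monotone_nat_of_le_succ fun n => by rw [start_succ]; omega

lemma start_add_eq (n : ℕ) : start (n + 1) + 2 ^ (n + 1) = n * 2 ^ (n + 1) + 2 := by
  induction n with
  | zero => simp [start]
  | succ n ih =>
    rw [start_succ]
    have : 2 ^ (n + 1 + 1) = 2 * 2 ^ (n + 1) := by ring
    nlinarith

lemma exists_zone (i : ℕ) : ∃ n, 1 ≤ n ∧ start n ≤ i ∧ i < start (n + 1) := by
  have hex : ∃ n, i < start (n + 1) := by
    refine ⟨i + 2, ?_⟩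
    have h1 := start_succ (i + 2)
    have h2 : 1 ≤ 2 ^ (i + 2) := Nat.one_le_two_pow
    nlinarith
  classical
  have h := Nat.find_spec hex
  have hmin := fun m => Nat.find_min hex (m := m)
  rcases hk : Nat.find hex with _ | k
  · rw [hk] at h; simp [start] at h
  · rw [hk] at h hmin
    exact ⟨k + 1, by omega, not_lt.1 (hmin k (by omega)), h⟩

/-- The number of repetitions of each rotation in zone `n`, i.e. the odd part of `n`. -/
def reps (n : ℕ) : ℕ := n / 2 ^ padicValNat 2 n

lemma pow_mul_reps (n : ℕ) : 2 ^ padicValNat 2 n * reps n = n :=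
  Nat.mul_div_cancel' pow_padicValNat_dvd

lemma reps_pos {n : ℕ} (hn : 1 ≤ n) : 0 < reps n := by
  rcases Nat.eq_zero_or_pos (reps n) with h | h
  · have := pow_mul_reps n
    rw [h] at this; omega
  · exact h

/-- `S` is made of zones, in which the periodic sequence `D n` is read `n` times, with shifts. -/
structure IsZoned (S : ℕ → Bool) (D : ℕ → ℕ → Bool) : Prop where
  periodic : ∀ n k, 1 ≤ n → D n (k + 2 ^ n) = D n k
  deBruijn : ∀ n, 1 ≤ n → ∀ w : List Bool, w.length = n →
    #{k ∈ range (2 ^ n) | win (D n) k n = w} = 1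
  zone_eq : ∀ n q r, 1 ≤ n → q < 2 ^ padicValNat 2 n → r < reps n * 2 ^ n →
    S (start n + q * (reps n * 2 ^ n) + r) = D n (q + r)

lemma win_flatMap {f : ℕ → Bool} {g : ℕ → List Bool} {T : ℕ} (hg : ∀ q, (g q).length = T) (a Q : ℕ)
    (h : win f a (Q * T) = (List.range Q).flatMap g) :
    ∀ q < Q, win f (a + q * T) T = g q := by
  induction Q with
  | zero => simp
  | succ Q ih =>
    rw [Nat.succ_mul, win_add, List.range_succ, List.flatMap_append] at h
    have hl : ((List.range Q).flatMap g).length = Q * T := by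
      simp [List.length_flatMap, hg]
    obtain ⟨h1, h2⟩ := List.append_inj h (by simp [hl])
    intro q hq
    rcases Nat.lt_succ_iff_lt_or_eq.1 hq with hq | rfl
    · exact ih h1 q hq
    · simpa using h2

lemma flatten_replicate_rotate (d : List Bool) (i t : ℕ) :
    (List.replicate t (d.rotate i)).flatten = win (cyc d) i (t * d.length) := by
  have key : ∀ t, win (cyc d) (i + t * d.length) d.length = d.rotate i := by
    intro t
    refine List.ext_getElem (by simp) fun j h1 h2 => ?_
    rw [getElem_win, List.getElem_rotate, cyc,
      List.getD_eq_getElem _ _ (Nat.mod_lt _ (by simp at h1; omega))]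
    congr 1
    rw [show i + t * d.length + j = j + i + d.length * t by ring, Nat.add_mul_mod_self_left]
  induction t with
  | zero => simp
  | succ t ih =>
    rw [List.replicate_succ', List.flatten_append, ih, Nat.succ_mul, win_add, key]
    simp

lemma zone_eq_flatMap (d : List Bool) (n : ℕ) (hd : d.length = 2 ^ n) :
    zone d n = (List.range (2 ^ padicValNat 2 n)).flatMap
      fun i => win (cyc d) i (reps n * 2 ^ n) := by
  unfold zone
  refine List.flatMap_congr fun i _ => ?_
  rw [← hd]
  exact flatten_replicate_rotate d i _

lemma length_zone (d : List Bool) (n : ℕ) (hd : d.length = 2 ^ n) :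
    (zone d n).length = n * 2 ^ n := by
  rw [zone_eq_flatMap d n hd]
  simp only [List.length_flatMap, length_win]
  simp only [List.map_const', List.sum_replicate, List.length_range, smul_eq_mul, ← mul_assoc,
    pow_mul_reps]

lemma length_zones (db : ℕ → List Bool) (hdb : ∀ n, 1 ≤ n → (db n).length = 2 ^ n) (N : ℕ) :
    ((List.range N).flatMap fun k => zone (db (k + 1)) (k + 1)).length = start (N + 1) := by
  induction N with
  | zero => simp [start]
  | succ N ih =>
    rw [List.range_succ, List.flatMap_append, List.length_append, ih, start_succ (N + 1)]
    simp [length_zone _ _ (hdb (N + 1) (by omega))]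

lemma isZoned {db : ℕ → List Bool} {S : ℕ → Bool} (hdb : ∀ n, 1 ≤ n → IsDeBruijn n (db n))
    (hS : IsZoneSequence db S) : IsZoned S (fun n => cyc (db n)) where
  periodic n k hn := by
    have := cyc_add_length (db n) k
    rwa [(hdb n hn).1] at this
  deBruijn n hn := ((isDeBruijn_iff hn).1 (hdb n hn)).2
  zone_eq n q r hn hq hr := by
    obtain ⟨N, rfl⟩ := Nat.exists_eq_add_of_le' hn
    have h1 := hS (N + 1)
    have h0 := hS N
    have hl := fun n hn => (hdb n hn).1
    simp only [length_zones db hl] at h1 h0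
    -- Cancelling the first `N` zones isolates zone `N + 1`.
    rw [pref_eq_win, start_succ (N + 1), win_add, List.range_succ, List.flatMap_append,
      ← h0, pref_eq_win, List.append_cancel_left_eq, zero_add, List.flatMap_singleton,
      zone_eq_flatMap _ _ (hl _ hn)] at h1
    have h2 := win_flatMap (f := S)
      (g := fun i => win (cyc (db (N + 1))) i (reps (N + 1) * 2 ^ (N + 1))) (fun q => length_win _ _ _)
      (start (N + 1)) (2 ^ padicValNat 2 (N + 1)) (by rw [← mul_assoc, pow_mul_reps]; exact h1) q hq
    exact win_eq_win_iff.1 h2 r hr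

namespace IsZoned

variable {S : ℕ → Bool} {D : ℕ → ℕ → Bool}

/-- The rotation used in copy `j` of zone `n`. -/
lemma copy_eq (h : IsZoned S D) {n j r : ℕ} (hn : 1 ≤ n) (hj : j < n) (hr : r < 2 ^ n) :
    S (start n + j * 2 ^ n + r) = D n (j / reps n + r) := by
  have hp : ∀ c k, D n (k + c * 2 ^ n) = D n k := by
    intro c k
    induction c with
    | zero => simp
    | succ c ih => rw [Nat.succ_mul, ← add_assoc, h.periodic n _ hn, ih]
  have ht := reps_pos hn
  have hq : j / reps n < 2 ^ padicValNat 2 n :=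
    Nat.div_lt_of_lt_mul (by rw [mul_comm, pow_mul_reps]; exact hj)
  have hm : j % reps n < reps n := Nat.mod_lt _ ht
  have := h.zone_eq n (j / reps n) (j % reps n * 2 ^ n + r) hn hq (by nlinarith)
  rw [show start n + j / reps n * (reps n * 2 ^ n) + (j % reps n * 2 ^ n + r)
    = start n + (reps n * (j / reps n) + j % reps n) * 2 ^ n + r by ring, Nat.div_add_mod,
    ← add_assoc, add_right_comm (j / reps n), hp] at this
  exact this

lemma div_reps_lt {n j : ℕ} (hj : j < n) : j / reps n < n :=
  lt_of_le_of_lt (Nat.div_le_self _ _) hj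

lemma win_copy (h : IsZoned S D) {n j r l : ℕ} (hn : 1 ≤ n) (hj : j < n) (hr : r + l ≤ 2 ^ n) :
    win S (start n + j * 2 ^ n + r) l = win (D n) (j / reps n + r) l := by
  refine win_eq_win_iff.2 fun i hi => ?_
  rw [add_assoc, h.copy_eq hn hj (by omega), add_assoc]

lemma win_periodic (h : IsZoned S D) {n : ℕ} (hn : 1 ≤ n) (l k : ℕ) :
    win (D n) (k + 2 ^ n) l = win (D n) k l :=
  win_eq_win_iff.2 fun i _ => by rw [add_right_comm, h.periodic n _ hn]

lemma win_mod (h : IsZoned S D) {n : ℕ} (hn : 1 ≤ n) (l k : ℕ) :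
    win (D n) (k % 2 ^ n) l = win (D n) k l :=
  Function.Periodic.map_mod_nat (f := fun k => win (D n) k l) (h.win_periodic hn l) k

/-- Downward induction from length `n`: every occurrence of `w` continues with exactly one of the
two bits, so each bit removed doubles the count. -/
lemma card_win_eq (h : IsZoned S D) {n : ℕ} (hn : 1 ≤ n) (w : List Bool) (hw : w.length ≤ n) :
    #{k ∈ range (2 ^ n) | win (D n) k w.length = w} = 2 ^ (n - w.length) := by
  obtain ⟨e, he⟩ := Nat.exists_eq_add_of_le hw
  induction e generalizing w with
  | zero => rw [add_zero] at he; rw [← he]; simpa using h.deBruijn n hn w he.symm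
  | succ e ih =>
    have key : {k ∈ range (2 ^ n) | win (D n) k w.length = w} =
        {k ∈ range (2 ^ n) | win (D n) k (w ++ [false]).length = w ++ [false]} ∪
        {k ∈ range (2 ^ n) | win (D n) k (w ++ [true]).length = w ++ [true]} := by
      ext k
      simp only [mem_union, mem_filter, List.length_append, List.length_singleton, win_succ]
      constructor
      · rintro ⟨h1, h2⟩
        rw [h2]
        cases D n (k + w.length) <;> simp [mem_range.1 h1]
      · rintro (⟨h1, h2⟩ | ⟨h1, h2⟩) <;> exact ⟨h1, (List.append_inj h2 (by simp)).1⟩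
    rw [key, card_union_of_disjoint, ih _ (by simp; omega) (by simp; omega),
      ih _ (by simp; omega) (by simp; omega), show n - w.length = e + 1 by omega]
    · simp only [List.length_append, List.length_singleton,
        show n - (w.length + 1) = e by omega]
      ring
    · rw [disjoint_filter]
      intro k _ h1 h2
      simp only [List.length_append, List.length_singleton] at h1 h2
      rw [h1] at h2
      simp at h2

/-- Already the first `n` bits of the window occur only once in a period. -/
lemma win_injOn (h : IsZoned S D) {n l : ℕ} (hn : 1 ≤ n) (hl : n ≤ l) :
    Set.InjOn (fun k => win (D n) k l) (Set.Iio (2 ^ n)) := by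
  intro a ha b hb hab
  have hab' : win (D n) a n = win (D n) b n := by
    have := congrArg (List.take n) hab
    simpa [win_take _ _ hl] using this
  have h1 := h.deBruijn n hn (win (D n) a n) (by simp)
  rw [card_eq_one] at h1
  obtain ⟨c, hc⟩ := h1
  have e1 : a ∈ ({c} : Finset ℕ) := hc ▸ mem_filter.2 ⟨mem_range.2 ha, rfl⟩
  have e2 : b ∈ ({c} : Finset ℕ) := hc ▸ mem_filter.2 ⟨mem_range.2 hb, hab'.symm⟩
  rw [mem_singleton] at e1 e2
  rw [e1, e2]

lemma modEq_of_win_eq (h : IsZoned S D) {n l a b : ℕ} (hn : 1 ≤ n) (hl : n ≤ l)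
    (hab : win (D n) a l = win (D n) b l) : a ≡ b [MOD 2 ^ n] := by
  have hp : 0 < 2 ^ n := by positivity
  refine h.win_injOn hn hl (Nat.mod_lt a hp) (Nat.mod_lt b hp) ?_
  simp only [h.win_mod hn, hab]

lemma card_win_le_four (h : IsZoned S D) {n : ℕ} (hn : 1 ≤ n) (w : List Bool)
    (hw : n ≤ w.length + 2) : #{k ∈ range (2 ^ n) | win (D n) k w.length = w} ≤ 4 := by
  rcases le_total w.length n with h1 | h1
  · rw [h.card_win_eq hn w h1]
    calc 2 ^ (n - w.length) ≤ 2 ^ 2 := Nat.pow_le_pow_right (by norm_num) (by omega)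
      _ = 4 := by norm_num
  · refine le_trans (card_le_one.2 fun a ha b hb => ?_) (by norm_num : 1 ≤ 4)
    simp only [mem_filter, mem_range] at ha hb
    exact h.win_injOn hn h1 ha.1 hb.1 (ha.2.trans hb.2.symm)

/-- The number of occurrences of a string that start in a copy is close to its number of
occurrences in the periodic sequence. -/
lemma card_copy (h : IsZoned S D) {n j : ℕ} (hn : 1 ≤ n) (hj : j < n) (w : List Bool) :
    #{r ∈ range (2 ^ n) | win S (start n + j * 2 ^ n + r) w.length = w} ≤
        #{k ∈ range (2 ^ n) | win (D n) k w.length = w} + w.length ∧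
      #{k ∈ range (2 ^ n) | win (D n) k w.length = w} ≤
        #{r ∈ range (2 ^ n) | win S (start n + j * 2 ^ n + r) w.length = w} + w.length := by
  have shift : #{r ∈ range (2 ^ n) | win (D n) (j / reps n + r) w.length = w} =
      #{k ∈ range (2 ^ n) | win (D n) k w.length = w} := by
    have hp : Function.Periodic (fun k => win (D n) k w.length = w) (2 ^ n) := fun k => by
      simp only [h.win_periodic hn]
    have e1 := Nat.filter_Ico_card_eq_of_periodic (j / reps n) (2 ^ n) _ hp
    rw [Nat.count_eq_card_filter_range] at e1
    rw [← e1]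
    refine card_bij (fun r _ => j / reps n + r) ?_ ?_ ?_
    · intro r hr
      simp only [mem_filter, mem_range, mem_Ico] at hr ⊢
      exact ⟨by omega, hr.2⟩
    · intro a _ b _ hab; omega
    · intro b hb
      simp only [mem_filter, mem_range, mem_Ico] at hb ⊢
      exact ⟨b - j / reps n, ⟨by omega, by rw [Nat.add_sub_cancel' hb.1.1]; exact hb.2⟩, by omega⟩
  rw [← shift]
  -- Only these starting positions have windows that leave the copy; all others agree with the
  -- periodic sequence.
  have hc : #{r ∈ range (2 ^ n) | ¬ r + w.length ≤ 2 ^ n} ≤ w.length := by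
    calc _ ≤ #(Ico (2 ^ n - w.length) (2 ^ n)) := card_le_card fun r hr => by
            simp only [mem_filter, mem_range, mem_Ico] at hr ⊢; omega
      _ ≤ _ := by rw [Nat.card_Ico]; omega
  constructor
  · refine (card_le_card ?_).trans ((card_union_le _ _).trans (Nat.add_le_add_left hc _))
    intro r hr
    simp only [mem_filter, mem_union] at hr ⊢
    by_cases h1 : r + w.length ≤ 2 ^ n
    · exact Or.inl ⟨hr.1, by rw [← h.win_copy hn hj h1]; exact hr.2⟩
    · exact Or.inr ⟨hr.1, h1⟩
  · refine (card_le_card ?_).trans ((card_union_le _ _).trans (Nat.add_le_add_left hc _))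
    intro r hr
    simp only [mem_filter, mem_union] at hr ⊢
    by_cases h1 : r + w.length ≤ 2 ^ n
    · exact Or.inl ⟨hr.1, by rw [h.win_copy hn hj h1]; exact hr.2⟩
    · exact Or.inr ⟨hr.1, h1⟩

end IsZoned

end PPMLZ

namespace PPMLZ

open Finset

/-! ### Existence of de Bruijn strings -/

/-- A permutation of the strings of length `m + 1` that shifts every string by one bit. -/
def IsShift {m : ℕ} (σ : Equiv.Perm (Fin (m + 1) → Bool)) : Prop :=
  ∀ y (k : Fin m), σ y k.castSucc = y k.succ

lemma isShift_rotate (m : ℕ) :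
    IsShift (Equiv.arrowCongr (finRotate (m + 1)).symm (Equiv.refl Bool)) := by
  intro y k
  simp only [Equiv.arrowCongr_apply, Equiv.symm_symm, Function.comp_apply,
    Equiv.coe_refl, id]
  rw [finRotate_apply, Fin.coeSucc_eq_succ]

/-- A transposition of points in different cycles merges these cycles: the new permutation sends
`y'` to `σ y` and then follows the old cycle through `y`. -/
lemma sameCycle_mul_swap {α : Type*} [Fintype α] [DecidableEq α] {σ : Equiv.Perm α} {x y y' : α}
    (hy : σ.SameCycle x y) (hy' : ¬ σ.SameCycle x y') :
    (σ * Equiv.swap y y').SameCycle x y' ∧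
      ∀ z, σ.SameCycle x z → (σ * Equiv.swap y y').SameCycle x z := by
  set τ := σ * Equiv.swap y y' with hτ
  have key : ∀ z, σ.SameCycle y z → τ.SameCycle y' z := by
    have step : ∀ i : ℕ, τ.SameCycle y' ((σ ^ (i + 1)) y) := by
      have base : τ.SameCycle y' (σ y) := ⟨1, by simp [hτ]⟩
      intro i
      induction i with
      | zero => simpa using base
      | succ i ih =>
        rw [pow_succ', Equiv.Perm.mul_apply]
        by_cases h : (σ ^ (i + 1)) y = y
        · rw [h]; exact base
        · have h' : (σ ^ (i + 1)) y ≠ y' := fun e =>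
            hy' (hy.trans ⟨(i + 1 : ℕ), by rw [zpow_natCast]; exact e⟩)
          refine ih.trans ⟨1, ?_⟩
          simp [hτ, Equiv.swap_apply_of_ne_of_ne h h']
    intro z hz
    obtain ⟨i, hi, -, rfl⟩ := hz.exists_pow_eq σ
    obtain ⟨j, rfl⟩ := Nat.exists_eq_add_of_le' hi
    exact step j
  have hx := key x hy.symm
  exact ⟨hx.symm, fun z hz => hx.symm.trans (key z (hy.symm.trans hz))⟩

/-- Slide a window along `x` followed by `w`: each move is a shift that appends one bit, and it
leads from `x` to `w`. -/
lemma shift_closed_eq_univ {m : ℕ} {O : Set (Fin (m + 1) → Bool)} {x : Fin (m + 1) → Bool}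
    (hx : x ∈ O)
    (hO : ∀ y ∈ O, ∀ z : Fin (m + 1) → Bool, (∀ k : Fin m, z k.castSucc = y k.succ) → z ∈ O)
    (w : Fin (m + 1) → Bool) : w ∈ O := by
  let g : ℕ → Bool := fun i =>
    if h : i < m + 1 then x ⟨i, h⟩ else if h' : i - (m + 1) < m + 1 then w ⟨i - (m + 1), h'⟩ else false
  have key : ∀ k, (fun i : Fin (m + 1) => g (k + i)) ∈ O := by
    intro k
    induction k with
    | zero =>
      convert hx using 2 with i
      rw [zero_add]
      exact dif_pos i.2
    | succ k ih =>
      refine hO _ ih _ fun i => ?_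
      simp only [Fin.val_castSucc, Fin.val_succ]
      congr 1; ring
  convert key (m + 1) using 2 with i
  simp only [g]
  rw [dif_neg (by omega), dif_pos (by omega)]
  simp only [Nat.add_sub_cancel_left]

/-- Among all shift permutations, take one whose cycle through `x` is largest. If flipping the first
bit of some `y` left the cycle, composing with the swap of the two strings would still be a shift,
as they agree after the first bit, and would enlarge the cycle. So the cycle is closed under this
flip, hence under appending either bit, and it contains every string. -/
lemma exists_shift_single_cycle (m : ℕ) (x : Fin (m + 1) → Bool) :
    ∃ σ : Equiv.Perm (Fin (m + 1) → Bool), IsShift σ ∧ ∀ y, σ.SameCycle x y := by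
  classical
  obtain ⟨σ, hσ, hmax⟩ := exists_max_image
    ({σ | IsShift σ} : Finset (Equiv.Perm (Fin (m + 1) → Bool)))
    (fun σ => #{y | σ.SameCycle x y}) ⟨_, mem_filter.2 ⟨mem_univ _, isShift_rotate m⟩⟩
  rw [mem_filter_univ] at hσ
  refine ⟨σ, hσ, fun w => ?_⟩
  by_cases hcl : ∀ y, σ.SameCycle x y → σ.SameCycle x (Function.update y 0 (!y 0))
  · refine shift_closed_eq_univ (O := {y | σ.SameCycle x y}) (Equiv.Perm.SameCycle.refl σ x) ?_ w
    intro y hy z hz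
    -- The preimage of `z` agrees with `y` except possibly in the first bit, so it lies in the
    -- cycle.
    set u := σ.symm z with hu
    have hzu : z = σ u := by simp [hu]
    have htail : ∀ k : Fin m, u k.succ = y k.succ := fun k => by rw [← hσ u k, ← hzu, hz k]
    have hux : σ.SameCycle x u := by
      by_cases h0 : u 0 = y 0
      · have : u = y := funext fun i => Fin.cases h0 htail i
        rw [this]; exact hy
      · have : u = Function.update y 0 (!y 0) := funext fun i => by
          refine Fin.cases ?_ (fun k => ?_) i
          · rw [Function.update_self]; exact Bool.eq_not_of_ne h0
          · rw [Function.update_of_ne (Fin.succ_ne_zero k)]; exact htail k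
        rw [this]; exact hcl y hy
    show σ.SameCycle x z
    rw [hzu]
    exact hux.trans ⟨1, by simp⟩
  · exfalso
    push Not at hcl
    obtain ⟨y, hy, hy'⟩ := hcl
    set y' := Function.update y 0 (!y 0) with hdef
    have htail : ∀ k : Fin m, y' k.succ = y k.succ := fun k => by
      rw [hdef, Function.update_of_ne (Fin.succ_ne_zero k)]
    have hτ : IsShift (σ * Equiv.swap y y') := by
      intro z k
      rw [Equiv.Perm.mul_apply, hσ]
      by_cases h1 : z = y
      · rw [h1, Equiv.swap_apply_left, htail]
      by_cases h2 : z = y'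
      · rw [h2, Equiv.swap_apply_right, htail]
      · rw [Equiv.swap_apply_of_ne_of_ne h1 h2]
    obtain ⟨h1, h2⟩ := sameCycle_mul_swap hy hy'
    have := hmax _ ((mem_filter_univ _).2 hτ)
    refine absurd this (not_le.2 (card_lt_card ⟨?_, ?_⟩))
    · intro z hz
      rw [mem_filter_univ] at hz ⊢
      exact h2 z hz
    · intro hsub
      have := hsub ((mem_filter_univ _).2 h1)
      rw [mem_filter_univ] at this
      exact hy' this

/-- The first bits along the single cycle of a shift form a periodic sequence whose windows of
length `n` are the points of the cycle, that is, all strings once. -/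
lemma exists_isDeBruijn {n : ℕ} (hn : 1 ≤ n) : ∃ d, IsDeBruijn n d := by
  obtain ⟨m, rfl⟩ := Nat.exists_eq_add_of_le' hn
  let x : Fin (m + 1) → Bool := fun _ => false
  obtain ⟨σ, hσ, hc⟩ := exists_shift_single_cycle m x
  have hcyc : σ.IsCycleOn ((univ : Finset (Fin (m + 1) → Bool)) : Set (Fin (m + 1) → Bool)) :=
    ⟨by simp, fun a _ b _ => (hc a).symm.trans (hc b)⟩
  have hcard : #(univ : Finset (Fin (m + 1) → Bool)) = 2 ^ (m + 1) := by simp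
  let f : ℕ → Bool := fun i => (σ ^ i) x 0
  have hshift : ∀ (i : ℕ) (hi : i < m + 1) (k : ℕ), f (k + i) = (σ ^ k) x ⟨i, hi⟩ := by
    intro i
    induction i with
    | zero => intro hi k; rfl
    | succ i ih =>
      intro hi k
      rw [← add_assoc, add_right_comm, ih (by omega) (k + 1), pow_succ', Equiv.Perm.mul_apply]
      exact hσ ((σ ^ k) x) ⟨i, by omega⟩
  have hper : Function.Periodic f (2 ^ (m + 1)) := fun k => by
    simp only [f]
    rw [pow_add, Equiv.Perm.mul_apply, ← hcard, hcyc.pow_card_apply (mem_univ _)]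
  have hcf : ∀ k, cyc (win f 0 (2 ^ (m + 1))) k = f k := by
    intro k
    rw [cyc, length_win, List.getD_eq_getElem _ _ (by simp [Nat.mod_lt]), getElem_win, zero_add,
      hper.map_mod_nat]
  refine ⟨win f 0 (2 ^ (m + 1)), (isDeBruijn_iff hn).2 ⟨by simp, fun w hw => ?_⟩⟩
  have hwin : ∀ k, win (cyc (win f 0 (2 ^ (m + 1)))) k (m + 1) = w ↔
      (σ ^ k) x = fun i : Fin (m + 1) => w[i]'(by omega) := by
    intro k
    have e : ∀ c, win c k (m + 1) = win c k w.length := fun c => by rw [hw]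
    rw [e, win_eq_iff, funext_iff]
    constructor
    · intro h i
      have := h i (by omega)
      rw [hcf, hshift i (by omega)] at this
      exact this
    · intro h i hi
      rw [hcf, hshift i (by omega), h]; rfl
  obtain ⟨k, hk, hkw⟩ := hcyc.exists_pow_eq (mem_univ x)
    (mem_univ (fun i : Fin (m + 1) => w[i]'(by omega)))
  rw [hcard] at hk
  rw [card_eq_one]
  refine ⟨k, ?_⟩
  ext k'
  rw [mem_filter, mem_singleton, hwin, ← hkw, mem_range]
  constructor
  · rintro ⟨h1, h2⟩
    have := (hcyc.pow_apply_eq_pow_apply (mem_univ x)).1 h2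
    rw [hcard] at this
    exact Nat.ModEq.eq_of_lt_of_lt this h1 hk
  · rintro rfl; exact ⟨hk, rfl⟩

lemma exists_isLeast_isDeBruijn {n : ℕ} (hn : 1 ≤ n) :
    ∃ d, IsLeast {x : List Bool | IsDeBruijn n x} d := by
  have hfin : {x : List Bool | IsDeBruijn n x}.Finite :=
    (List.finite_length_eq Bool (2 ^ n)).subset fun x hx => hx.1
  obtain ⟨d, hd, hmin⟩ := hfin.exists_minimal (exists_isDeBruijn hn)
  exact ⟨d, hd, fun x hx => (le_total d x).elim id fun h => hmin hx h⟩

lemma exists_isZoneSequence {db : ℕ → List Bool} (hdb : ∀ n, 1 ≤ n → (db n).length = 2 ^ n) :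
    ∃ S, IsZoneSequence db S := by
  set p : ℕ → List Bool := fun N => (List.range N).flatMap fun k => zone (db (k + 1)) (k + 1)
    with hp
  have hlen : ∀ N, (p N).length = start (N + 1) := length_zones db hdb
  have hmono : ∀ N M, N ≤ M → p N <+: p M := by
    intro N M h
    obtain ⟨k, rfl⟩ := Nat.exists_eq_add_of_le h
    rw [hp]
    simp only [List.range_add, List.flatMap_append]
    exact List.prefix_append _ _
  have hbig : ∀ i, i < (p (i + 1)).length := by
    intro i
    rw [hlen, start_succ]
    have : 1 ≤ 2 ^ (i + 1) := Nat.one_le_two_pow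
    nlinarith
  refine ⟨fun i => (p (i + 1)).getD i false, fun N => ?_⟩
  show pref _ (p N).length = p N
  rw [pref_eq_win, win_eq_iff]
  intro i hi
  rw [zero_add, List.getD_eq_getElem _ _ (hbig i)]
  rcases le_total N (i + 1) with h | h
  · exact ((hmono _ _ h).getElem hi).symm
  · exact (hmono _ _ h).getElem (hbig i)

end PPMLZ

namespace PPMLZ

open Finset Filter Asymptotics Topology

/-! ### Averages over zones -/

/-- This permits charging a prefix that ends inside zone `n` with the error of the complete zone. -/
lemma start_succ_le {n : ℕ} (hn : 2 ≤ n) : start (n + 1) ≤ 8 * start n := by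
  induction n, hn using Nat.le_induction with
  | base => simp [start, sum_range_succ]
  | succ n hn ih =>
    rw [start_succ (n + 1)]
    have h1 := start_succ n
    have : 2 ^ (n + 1) = 2 * 2 ^ n := by ring
    nlinarith [Nat.zero_le (2 ^ n), Nat.mul_le_mul_right (2 ^ n) hn]

lemma two_pow_isLittleO : (fun n : ℕ => (2 : ℝ) ^ n) =o[atTop] fun n : ℕ => (n : ℝ) * 2 ^ n := by
  have h1 : (fun _ : ℕ => (1 : ℝ)) =o[atTop] fun n : ℕ => (n : ℝ) :=
    isLittleO_const_left.2 (Or.inr (tendsto_norm_atTop_atTop.comp tendsto_natCast_atTop_atTop))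
  simpa using h1.mul_isBigO (isBigO_refl (fun n : ℕ => (2 : ℝ) ^ n) atTop)

lemma tendsto_start : Tendsto start atTop atTop := by
  refine tendsto_atTop_mono' _ ?_ (tendsto_id (α := ℕ))
  filter_upwards [eventually_ge_atTop 3] with n hn
  obtain ⟨m, rfl⟩ := Nat.exists_eq_add_of_le hn
  have h := start_succ (2 + m)
  have : 2 + m < 2 ^ (2 + m) := Nat.lt_two_pow_self
  rw [show 3 + m = 2 + m + 1 by ring, h, id]
  nlinarith

lemma tendsto_average_zero {f E : ℕ → ℝ} (hE : E =o[atTop] fun n : ℕ => (n : ℝ) * 2 ^ n)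
    (hf : ∀ n, ∀ r ≤ n * 2 ^ n, |∑ i ∈ range r, f (start n + i)| ≤ E n) :
    Tendsto (fun m : ℕ => (∑ i ∈ range m, f i) / m) atTop (𝓝 0) := by
  have hE0 : ∀ n, 0 ≤ E n := fun n => by simpa using hf n 0 (Nat.zero_le _)
  have hs : ∀ n, ((start n : ℕ) : ℝ) = ∑ k ∈ range n, (k : ℝ) * 2 ^ k := fun n => by simp [start]
  have hsum : (fun n => ∑ k ∈ range n, E k) =o[atTop] fun n => ((start n : ℕ) : ℝ) := by
    simp only [hs]
    refine hE.sum_range (fun n => by positivity) ?_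
    simp only [← hs]
    exact tendsto_natCast_atTop_atTop.comp tendsto_start
  have hfull : ∀ n, |∑ i ∈ range (start n), f i| ≤ ∑ k ∈ range n, E k := by
    intro n
    induction n with
    | zero => simp [start]
    | succ n ih =>
      rw [start_succ, sum_range_add, sum_range_succ]
      exact (abs_add_le _ _).trans (add_le_add ih (hf n _ le_rfl))
  rw [Metric.tendsto_atTop]
  intro ε hε
  -- A factor 8 is lost in `start_succ_le`, and a factor 2 gives strictness.
  obtain ⟨N, hN⟩ := eventually_atTop.1 (hsum.bound (show 0 < ε / 16 by positivity))
  refine ⟨start (N + 3) + 1, fun m hm => ?_⟩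
  obtain ⟨n, hn1, hn2, hn3⟩ := exists_zone m
  have hNn : N + 3 < n + 1 := by
    by_contra hlt
    have := start_mono (not_lt.1 hlt)
    omega
  obtain ⟨r, rfl⟩ := Nat.exists_eq_add_of_le hn2
  have hr : r ≤ n * 2 ^ n := by rw [start_succ] at hn3; omega
  have h1 : |∑ i ∈ range (start n + r), f i| ≤ ∑ k ∈ range (n + 1), E k := by
    rw [sum_range_add, sum_range_succ]
    exact (abs_add_le _ _).trans (add_le_add (hfull n) (hf n _ hr))
  have h2 := hN (n + 1) (by omega)
  rw [Real.norm_of_nonneg (sum_nonneg fun k _ => hE0 k), Real.norm_of_nonneg (by positivity)] at h2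
  have h3 : ((start (n + 1) : ℕ) : ℝ) ≤ 8 * (start n : ℕ) := by
    exact_mod_cast start_succ_le (by omega)
  have hmpos : (0 : ℝ) < ((start n + r : ℕ) : ℝ) := by
    exact_mod_cast (by omega : 0 < start n + r)
  rw [Real.dist_eq, sub_zero, abs_div, abs_of_pos hmpos, div_lt_iff₀ hmpos]
  push_cast at hmpos ⊢
  have : (0 : ℝ) ≤ r := by positivity
  nlinarith

/-- Complete copies contribute at most `A` each; the unfinished one is bounded by its length. -/
lemma abs_sum_zone_le {f : ℕ → ℝ} {A : ℝ} {n r : ℕ} (hA : 0 ≤ A) (hf : ∀ i, |f i| ≤ 1)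
    (hc : ∀ j < n, |∑ r ∈ range (2 ^ n), f (start n + j * 2 ^ n + r)| ≤ A) (hr : r ≤ n * 2 ^ n) :
    |∑ i ∈ range r, f (start n + i)| ≤ n * A + 2 ^ n := by
  have hfull : ∀ j ≤ n, |∑ i ∈ range (j * 2 ^ n), f (start n + i)| ≤ j * A := by
    intro j
    induction j with
    | zero => simp
    | succ j ih =>
      intro hj
      rw [Nat.succ_mul, sum_range_add]
      refine (abs_add_le _ _).trans ?_
      have := hc j (by omega)
      simp only [add_assoc] at this
      push_cast
      linarith [ih (by omega)]
  have hp : 0 < 2 ^ n := by positivity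
  have hrn : r / 2 ^ n ≤ n := Nat.div_le_of_le_mul (by rw [mul_comm]; exact hr)
  conv_lhs => rw [← Nat.div_add_mod' r (2 ^ n), sum_range_add]
  refine (abs_add_le _ _).trans (add_le_add ((hfull _ hrn).trans ?_) ?_)
  · have : ((r / 2 ^ n : ℕ) : ℝ) ≤ n := by exact_mod_cast hrn
    gcongr
  · refine (abs_sum_le_sum_abs _ _).trans ((sum_le_card_nsmul _ _ 1 fun i _ => hf _).trans ?_)
    have : ((r % 2 ^ n : ℕ) : ℝ) ≤ 2 ^ n := by exact_mod_cast (Nat.mod_lt r hp).le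
    simpa using this

/-! ### Normality -/

theorem IsZoned.isNormal {S : ℕ → Bool} {D : ℕ → ℕ → Bool} (h : IsZoned S D) : IsNormal S := by
  intro w
  set l := w.length with hl
  set c : ℝ := (1 / 2) ^ l with hc
  have hc0 : 0 ≤ c := by positivity
  have hc1 : c ≤ 1 := pow_le_one₀ (by norm_num) (by norm_num)
  let f : ℕ → ℝ := fun i => (if win S i l = w then 1 else 0) - c
  have hf1 : ∀ i, |f i| ≤ 1 := by
    intro i
    simp only [f, abs_le]
    split_ifs <;> constructor <;> linarith
  have hsum : ∀ (a m : ℕ), ∑ i ∈ range m, f (a + i) =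
      (#{i ∈ range m | win S (a + i) l = w} : ℝ) - m * c := by
    intro a m
    simp [f, sum_sub_distrib]
  -- The finitely many zones with `n < l` or `n = 0` get the trivial bound.
  let E : ℕ → ℝ := fun n => if l ≤ n ∧ 1 ≤ n then n * (l : ℝ) + 2 ^ n else n * 2 ^ n
  have hE : E =o[atTop] fun n : ℕ => (n : ℝ) * 2 ^ n := by
    have e : (fun n : ℕ => (n : ℝ) * (l : ℝ) + 2 ^ n) =ᶠ[atTop] E := by
      filter_upwards [eventually_ge_atTop l, eventually_ge_atTop 1] with n h1 h2
      simp [E, h1, h2]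
    refine IsLittleO.congr' (IsLittleO.add ?_ two_pow_isLittleO) e EventuallyEq.rfl
    refine (isBigO_refl _ _).mul_isLittleO (isLittleO_const_left.2 (Or.inr ?_))
    exact tendsto_norm_atTop_atTop.comp (tendsto_pow_atTop_atTop_of_one_lt (by norm_num))
  have hfE : ∀ n, ∀ r ≤ n * 2 ^ n, |∑ i ∈ range r, f (start n + i)| ≤ E n := by
    intro n r hr
    by_cases hn : l ≤ n ∧ 1 ≤ n
    · simp only [E, if_pos hn]
      refine abs_sum_zone_le (by positivity) hf1 (fun j hj => ?_) hr
      obtain ⟨h1, h2⟩ := h.card_copy hn.2 hj w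
      rw [h.card_win_eq hn.2 w hn.1] at h1 h2
      rw [hsum, abs_le]
      have e : ((2 ^ n : ℕ) : ℝ) * c = ((2 ^ (n - l) : ℕ) : ℝ) := by
        push_cast
        rw [hc, one_div, inv_pow, pow_sub₀ (2 : ℝ) (by norm_num) hn.1]
      rw [e]
      have h1' : (#{r ∈ range (2 ^ n) | win S (start n + j * 2 ^ n + r) l = w} : ℝ) ≤
        ((2 ^ (n - l) : ℕ) : ℝ) + l := by exact_mod_cast h1
      have h2' : ((2 ^ (n - l) : ℕ) : ℝ) ≤
        (#{r ∈ range (2 ^ n) | win S (start n + j * 2 ^ n + r) l = w} : ℝ) + l := by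
        exact_mod_cast h2
      constructor <;> linarith
    · simp only [E, if_neg hn]
      refine (abs_sum_le_sum_abs _ _).trans ((sum_le_card_nsmul _ _ 1 fun i _ => hf1 _).trans ?_)
      simp only [card_range, nsmul_eq_mul, mul_one]
      exact_mod_cast hr
  have havg := tendsto_average_zero hE hfE
  have hocc : ∀ m, |(occ w (pref S m) : ℝ) - #{i ∈ range m | win S i l = w}| ≤ l + 1 := by
    intro m
    rw [occ_pref, abs_le]
    have h1 : #{i ∈ range (m + 1) | i + l ≤ m ∧ win S i l = w} ≤
        #{i ∈ range m | win S i l = w} + 1 := by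
      rw [range_add_one, filter_insert]
      have : #{i ∈ range m | i + l ≤ m ∧ win S i l = w} ≤ #{i ∈ range m | win S i l = w} :=
        card_le_card fun i hi => by
          simp only [mem_filter] at hi ⊢; exact ⟨hi.1, hi.2.2⟩
      split_ifs
      · exact (card_insert_le _ _).trans (by omega)
      · omega
    have h2 : #{i ∈ range m | win S i l = w} ≤
        #{i ∈ range (m + 1) | i + l ≤ m ∧ win S i l = w} + l := by
      have : #(Ico (m - l) m) ≤ l := by rw [Nat.card_Ico]; omega
      refine (card_le_card ?_).trans ((card_union_le _ _).trans (Nat.add_le_add_left this _))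
      intro i hi
      simp only [mem_filter, mem_union, mem_range, mem_Ico] at hi ⊢
      by_cases h : i + l ≤ m
      · exact Or.inl ⟨by omega, h, hi.2⟩
      · exact Or.inr ⟨by omega, hi.1⟩
    have h1' : (#{i ∈ range (m + 1) | i + l ≤ m ∧ win S i l = w} : ℝ) ≤
        #{i ∈ range m | win S i l = w} + 1 := by exact_mod_cast h1
    have h2' : (#{i ∈ range m | win S i l = w} : ℝ) ≤
        #{i ∈ range (m + 1) | i + l ≤ m ∧ win S i l = w} + l := by exact_mod_cast h2
    have : (0 : ℝ) ≤ l := by positivity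
    constructor <;> linarith
  have hdiff : Tendsto (fun m : ℕ =>
      ((occ w (pref S m) : ℝ) - #{i ∈ range m | win S i l = w}) / m) atTop (𝓝 0) := by
    refine squeeze_zero_norm (fun m => ?_) (tendsto_const_div_atTop_nhds_zero_nat ((l : ℝ) + 1))
    rw [Real.norm_eq_abs, abs_div, Nat.abs_cast]
    exact div_le_div_of_nonneg_right (hocc m) (by positivity)
  have := (hdiff.add havg).add_const c
  rw [add_zero, zero_add] at this
  refine this.congr' ?_
  filter_upwards [eventually_ge_atTop 1] with m hm
  have hs := hsum 0 m
  simp only [zero_add] at hs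
  have hm' : (m : ℝ) ≠ 0 := by positivity
  rw [hs]
  field_simp
  ring

end PPMLZ

namespace PPMLZ

open Finset Filter Topology

/-! ### General bounds for Lempel-Ziv 78 -/

lemma lzState_append_singleton (x : List Bool) (b : Bool) :
    lzState (x ++ [b]) = lzStep (lzState x) b := by simp [lzState]

/-- Closure under `dropLast` makes every pointer the index of an actual dictionary entry. -/
lemma lzState_invariant (x : List Bool) :
    (lzState x).1.Nodup ∧ (∃ t, (lzState x).1 = [] :: t) ∧
      (∀ p ∈ (lzState x).1, p.dropLast ∈ (lzState x).1) ∧ (lzState x).2 ∈ (lzState x).1 := by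
  induction x using List.reverseRecOn with
  | nil => simp [lzState]
  | append_singleton x b ih =>
    obtain ⟨h1, ⟨t, h2⟩, h3, h4⟩ := ih
    rw [lzState_append_singleton, lzStep]
    split_ifs with h
    · exact ⟨h1, ⟨t, h2⟩, h3, h⟩
    · refine ⟨?_, ⟨t ++ [(lzState x).2 ++ [b]], by simp [h2]⟩, ?_, by simp [h2]⟩
      · rw [← List.concat_eq_append]
        exact h1.concat h
      · intro p hp
        rw [List.mem_append, List.mem_singleton] at hp ⊢
        rcases hp with hp | rfl
        · exact Or.inl (h3 p hp)
        · left; rwa [List.dropLast_concat]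

/-- The strings of length less than `L`. -/
def shortStrings (L : ℕ) : Finset (List Bool) :=
  (range L).biUnion fun l => (univ : Finset (Fin l → Bool)).image List.ofFn

lemma mem_shortStrings {L : ℕ} {w : List Bool} (h : w.length < L) : w ∈ shortStrings L := by
  simp only [shortStrings, mem_biUnion, mem_range, mem_image, mem_univ, true_and]
  exact ⟨w.length, h, w.get, List.ofFn_get w⟩

lemma card_shortStrings_le (L : ℕ) : #(shortStrings L) ≤ 2 ^ L := by
  refine card_biUnion_le.trans ((sum_le_sum fun l _ => card_image_le).trans ?_)
  simp only [card_univ, Fintype.card_fun, Fintype.card_bool, Fintype.card_fin]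
  exact (Nat.geomSum_lt le_rfl fun k hk => mem_range.1 hk).le

/-- A phrase is determined by its pointer code and last bit, so at most `2 ^ (L + 1)` phrases have a
pointer code shorter than `L`; each of the others costs at least `L`. The empty `x_0` is in the
dictionary but is not a phrase. -/
lemma lz_lower_bound {c : ℕ → List Bool} (hc : Function.Injective c) (x : List Bool) (L : ℕ) :
    ((lzState x).1.length - 1) * L ≤ (lz c x).length + 2 ^ (L + 1) * L := by
  obtain ⟨h1, ⟨t, h2⟩, h3, -⟩ := lzState_invariant x
  set d := (lzState x).1 with hd
  let ptr : List Bool → List Bool := fun p => c (d.idxOf p.dropLast)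
  have ht : t.Nodup := by rw [h2] at h1; exact (List.nodup_cons.1 h1).2
  have htne : ∀ p ∈ t, p ≠ [] := by
    rintro p hp rfl
    rw [h2] at h1
    exact (List.nodup_cons.1 h1).1 hp
  have htd : ∀ p ∈ t, p ∈ d := fun p hp => by rw [h2]; exact List.mem_cons_of_mem _ hp
  have hlen : ∑ p ∈ t.toFinset, (ptr p).length ≤ (lz c x).length := by
    rw [List.sum_toFinset _ ht, lz, lzPhrases, ← hd, List.flatMap_append, List.length_append,
      h2, List.tail_cons, List.length_flatMap, ← h2]
    refine le_trans (List.sum_le_sum fun p _ => ?_) (Nat.le_add_right _ _)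
    simp [ptr]
  have hbad : #{p ∈ t.toFinset | (ptr p).length < L} ≤ 2 ^ (L + 1) := by
    have : #(shortStrings L ×ˢ (univ : Finset Bool)) ≤ 2 ^ (L + 1) := by
      rw [card_product, pow_succ]
      exact Nat.mul_le_mul (card_shortStrings_le L) (by simp)
    refine le_trans (card_le_card_of_injOn (fun p => (ptr p, p.getLastD false)) ?_ ?_) this
    · intro p hp
      rw [coe_filter] at hp
      simpa using mem_shortStrings hp.2
    · intro p hp q hq hpq
      simp only [coe_filter, List.mem_toFinset, Set.mem_ofPred_eq] at hp hq
      simp only [Prod.mk.injEq] at hpq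
      have e : p.dropLast = q.dropLast :=
        (List.idxOf_inj (h3 p (htd p hp.1))).1 (hc hpq.1)
      rw [← List.dropLast_append_getLast (htne p hp.1), ← List.dropLast_append_getLast (htne q hq.1),
        e]
      have e2 := hpq.2
      rw [List.getLastD_eq_getLast?, List.getLastD_eq_getLast?, List.getLast?_eq_getLast_of_ne_nil (htne p hp.1),
        List.getLast?_eq_getLast_of_ne_nil (htne q hq.1)] at e2
      simpa using e2
  have hsum : #{p ∈ t.toFinset | ¬ (ptr p).length < L} * L ≤ ∑ p ∈ t.toFinset, (ptr p).length := by
    rw [← smul_eq_mul]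
    refine le_trans (card_nsmul_le_sum _ _ _ fun p hp => ?_)
      (sum_le_sum_of_subset (filter_subset (fun p => ¬ (ptr p).length < L) _))
    exact not_lt.1 (mem_filter.1 hp).2
  have hcard : #t.toFinset = t.length := List.toFinset_card_of_nodup ht
  rw [← card_filter_add_card_filter_not (s := t.toFinset) fun p => (ptr p).length < L] at hcard
  rw [h2, List.length_cons, Nat.add_sub_cancel, ← hcard]
  nlinarith [Nat.mul_le_mul_right L hbad]

lemma lz_upper_bound {c : ℕ → List Bool} {x : List Bool} {M : ℝ} (hM : 0 ≤ M)
    (hc : ∀ i < (lzState x).1.length, ((c i).length : ℝ) ≤ M) :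
    ((lz c x).length : ℝ) ≤ (lzState x).1.length * (M + 1) := by
  obtain ⟨-, ⟨t, h2⟩, h3, h4⟩ := lzState_invariant x
  have hmem : ∀ p ∈ lzPhrases x, p.dropLast ∈ (lzState x).1 := by
    intro p hp
    rw [lzPhrases, List.mem_append] at hp
    rcases hp with hp | hp
    · exact h3 p (List.mem_of_mem_tail hp)
    · split_ifs at hp with h
      · simp at hp
      · rw [List.mem_singleton] at hp
        rw [hp]; exact h3 _ h4
  -- A possible unfinished phrase takes the place of `x_0`.
  have hlen : (lzPhrases x).length ≤ (lzState x).1.length := by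
    rw [lzPhrases, h2, List.length_append]
    split_ifs <;> simp
  have key : ∀ l : List (List Bool), (∀ p ∈ l, p.dropLast ∈ (lzState x).1) →
      ((l.flatMap fun p => c ((lzState x).1.idxOf p.dropLast) ++ [p.getLastD false]).length : ℝ) ≤
        l.length * (M + 1) := by
    intro l
    induction l with
    | nil => simp
    | cons p l ih =>
      intro h
      have e1 := ih fun q hq => h q (List.mem_cons_of_mem _ hq)
      have e2 := hc _ (List.idxOf_lt_length_of_mem (h p List.mem_cons_self))
      rw [List.flatMap_cons, List.length_append, List.length_append, List.length_singleton,
        List.length_cons]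
      push_cast
      nlinarith
  refine (key _ hmem).trans ?_
  have : ((lzPhrases x).length : ℝ) ≤ (lzState x).1.length := by exact_mod_cast hlen
  gcongr

/-! ### The parsing of a zoned sequence -/

/-- The aligned block number `a` of zone `n`. -/
def block (S : ℕ → Bool) (n a : ℕ) : List Bool := win S (start n + a * n) n

@[simp] lemma length_block (S : ℕ → Bool) (n a : ℕ) : (block S n a).length = n := by simp [block]

/-- All blocks of the zones before zone `n`, and the first `a` blocks of zone `n`. -/
def blocks (S : ℕ → Bool) (n a : ℕ) : List (List Bool) :=
  (List.range n).flatMap (fun k => (List.range (2 ^ k)).map (block S k)) ++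
    (List.range a).map (block S n)

lemma blocks_succ (S : ℕ → Bool) (n a : ℕ) : blocks S n (a + 1) = blocks S n a ++ [block S n a] := by
  simp [blocks, List.range_succ]

lemma blocks_succ_zero (S : ℕ → Bool) (n : ℕ) : blocks S (n + 1) 0 = blocks S n (2 ^ n) := by
  simp [blocks, List.range_succ]

/-- Zone `0` counts as one empty block, which plays the role of `x_0`. -/
lemma length_blocks (S : ℕ → Bool) (n a : ℕ) : (blocks S n a).length + 1 = 2 ^ n + a := by
  induction n generalizing a with
  | zero => simp [blocks, add_comm]
  | succ n ih =>
    induction a with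
    | zero => rw [blocks_succ_zero, ih]; ring
    | succ a iha => rw [blocks_succ, List.length_append, List.length_singleton]; omega

lemma mem_blocks {S : ℕ → Bool} {n a : ℕ} {p : List Bool} :
    p ∈ blocks S n a ↔ (∃ k < n, ∃ b < 2 ^ k, block S k b = p) ∨ ∃ b < a, block S n b = p := by
  simp [blocks]

lemma coprime_reps_two_pow {n : ℕ} (hn : 1 ≤ n) (k : ℕ) : Nat.Coprime (2 ^ k) (reps n) := by
  refine Nat.Coprime.pow_left k ((Nat.Prime.coprime_iff_not_dvd Nat.prime_two).2 ?_)
  have := Nat.not_dvd_ordCompl Nat.prime_two (n := n) (by omega)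
  rwa [Nat.factorization_def _ Nat.prime_two] at this

lemma padicValNat_lt_self {n : ℕ} (hn : 1 ≤ n) : padicValNat 2 n < n := by
  have h1 : 2 ^ padicValNat 2 n ≤ n := Nat.le_of_dvd hn pow_padicValNat_dvd
  exact lt_of_lt_of_le Nat.lt_two_pow_self h1

namespace IsZoned

variable {S : ℕ → Bool} {D : ℕ → ℕ → Bool}

lemma block_eq (h : IsZoned S D) {n q a : ℕ} (hn : 1 ≤ n) (hq : q < 2 ^ padicValNat 2 n)
    (ha : a < 2 ^ (n - padicValNat 2 n)) :
    block S n (q * 2 ^ (n - padicValNat 2 n) + a) = win (D n) (q + a * n) n := by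
  have hs := padicValNat_lt_self hn
  have hnr := pow_mul_reps n
  set s := padicValNat 2 n
  -- The part of the zone with a fixed rotation is exactly `2 ^ (n - s)` blocks long.
  have e : 2 ^ (n - s) * n = reps n * 2 ^ n := by
    calc 2 ^ (n - s) * n = 2 ^ (n - s) * (2 ^ s * reps n) := by rw [hnr]
      _ = _ := by rw [← mul_assoc, ← pow_add, Nat.sub_add_cancel hs.le, mul_comm]
  refine win_eq_win_iff.2 fun i hi => ?_
  have := h.zone_eq n q (a * n + i) hn hq (by rw [← e]; nlinarith)
  rw [← e] at this
  rw [add_assoc q, ← this]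
  congr 1; ring

/-- A block determines its position `q + a * n` modulo `2 ^ n`. As `2 ^ s` divides `n`, reduction
modulo `2 ^ s` gives `q`. After cancelling `q` and `2 ^ s`, the product of `a` and the odd number
`reps n` is known modulo `2 ^ (n - s)`, which gives `a`. -/
lemma block_injOn (h : IsZoned S D) {n : ℕ} (hn : 1 ≤ n) :
    Set.InjOn (block S n) (Set.Iio (2 ^ n)) := by
  have hs := padicValNat_lt_self hn
  have hnr := pow_mul_reps n
  set s := padicValNat 2 n
  have e : 2 ^ n = 2 ^ s * 2 ^ (n - s) := by rw [← pow_add, Nat.add_sub_cancel' hs.le]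
  have hA : 0 < 2 ^ (n - s) := by positivity
  have hdiv : ∀ a < 2 ^ n, a / 2 ^ (n - s) < 2 ^ s := fun a ha =>
    Nat.div_lt_of_lt_mul (by rw [mul_comm, ← e]; exact ha)
  have hb : ∀ a < 2 ^ n, block S n a = win (D n) (a / 2 ^ (n - s) + a % 2 ^ (n - s) * n) n := by
    intro a ha
    rw [← h.block_eq hn (hdiv a ha) (Nat.mod_lt _ hA), Nat.div_add_mod']
  intro a ha b hb' hab
  rw [hb a ha, hb b hb'] at hab
  have hm := h.modEq_of_win_eq hn le_rfl hab
  have hz : ∀ k, k * n ≡ 0 [MOD 2 ^ s] := fun k =>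
    (Nat.modEq_zero_iff_dvd).2 (Dvd.dvd.mul_left ⟨reps n, hnr.symm⟩ k)
  have hq : a / 2 ^ (n - s) = b / 2 ^ (n - s) := by
    have h1 := hm.of_dvd (Dvd.intro _ e.symm)
    have h2 := (((hz (a % 2 ^ (n - s))).add_left (a / 2 ^ (n - s))).symm.trans h1).trans
      ((hz (b % 2 ^ (n - s))).add_left (b / 2 ^ (n - s)))
    exact Nat.ModEq.eq_of_lt_of_lt h2 (hdiv a ha) (hdiv b hb')
  rw [hq] at hm
  have hm2 := Nat.ModEq.add_left_cancel' _ hm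
  have e' : ∀ k, k * n = 2 ^ s * (k * reps n) := fun k => by rw [mul_left_comm, hnr]
  rw [e', e' (b % _), e] at hm2
  have hm3 := Nat.ModEq.mul_left_cancel' (by positivity) hm2
  have hm4 := Nat.ModEq.cancel_right_of_coprime
    (by simpa using coprime_reps_two_pow hn (n - s)) hm3
  have hr := Nat.ModEq.eq_of_lt_of_lt hm4 (Nat.mod_lt _ hA) (Nat.mod_lt _ hA)
  rw [← Nat.div_add_mod' a (2 ^ (n - s)), ← Nat.div_add_mod' b (2 ^ (n - s)), hq, hr]

lemma exists_block_eq (h : IsZoned S D) {n : ℕ} {v : List Bool} (hv : v.length = n) :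
    ∃ a < 2 ^ n, block S n a = v := by
  rcases Nat.eq_zero_or_pos n with rfl | hn
  · exact ⟨0, by simp, by rw [List.length_eq_zero_iff.1 hv]; simp [block]⟩
  have hmem : ∀ w : List Bool, w.length = n → w ∈ (range (2 ^ n)).image fun k => win (D n) k n := by
    intro w hw
    obtain ⟨k, hk⟩ := card_pos.1 (by rw [h.deBruijn n hn w hw]; exact one_pos)
    rw [mem_filter] at hk
    exact mem_image.2 ⟨k, hk.1, hk.2⟩
  have heq : (range (2 ^ n)).image (block S n) = (range (2 ^ n)).image fun k => win (D n) k n := by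
    refine eq_of_subset_of_card_le (fun w hw => ?_) (card_image_le.trans ?_)
    · obtain ⟨a, -, rfl⟩ := mem_image.1 hw
      exact hmem _ (by simp)
    · rw [card_image_of_injOn fun a ha b hb => h.block_injOn hn (by simpa using ha) (by simpa using hb)]
  have := hmem v hv
  rw [← heq, mem_image] at this
  obtain ⟨a, ha, hav⟩ := this
  exact ⟨a, mem_range.1 ha, hav⟩

/-- A proper prefix of a block is in the dictionary, since an earlier zone supplied all strings of
its length; the complete block is new, since the blocks of a zone are distinct. So each phrase ends
exactly at a block boundary. -/
lemma lzState_pref (h : IsZoned S D) {n a r : ℕ} (hn : 1 ≤ n) (ha : a < 2 ^ n) (hr : r < n) :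
    lzState (pref S (start n + a * n + r)) = (blocks S n a, win S (start n + a * n) r) := by
  have inner : ∀ n a, a < 2 ^ n → lzState (pref S (start n + a * n)) = (blocks S n a, []) →
      ∀ r < n, lzState (pref S (start n + a * n + r)) = (blocks S n a, win S (start n + a * n) r) := by
    intro n a ha h0 r
    induction r with
    | zero => intro _; rw [add_zero, h0, win_zero]
    | succ r ih =>
      intro hr
      rw [← add_assoc, pref_succ, lzState_append_singleton, ih (by omega), lzStep, ← win_succ, if_pos]
      obtain ⟨b, hb, hb'⟩ := h.exists_block_eq (v := win S (start n + a * n) (r + 1)) rfl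
      rw [length_win] at hb hb'
      exact mem_blocks.2 (Or.inl ⟨r + 1, hr, b, hb, hb'⟩)
  have next : ∀ n a, 1 ≤ n → a < 2 ^ n → lzState (pref S (start n + a * n)) = (blocks S n a, []) →
      lzState (pref S (start n + (a + 1) * n)) = (blocks S n (a + 1), []) := by
    intro n a hn ha h0
    obtain ⟨m, rfl⟩ := Nat.exists_eq_add_of_le' hn
    rw [show start (m + 1) + (a + 1) * (m + 1) = start (m + 1) + a * (m + 1) + m + 1 by ring,
      pref_succ, lzState_append_singleton, inner _ _ ha h0 m (by omega), lzStep, ← win_succ, if_neg,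
      blocks_succ]
    · rfl
    · intro hmem
      rcases mem_blocks.1 hmem with ⟨k, hk, b, hb, e⟩ | ⟨b, hb, e⟩
      · have := congrArg List.length e
        simp at this; omega
      · have := h.block_injOn hn (hb.trans ha) ha e
        omega
  have outer : ∀ n, 1 ≤ n → lzState (pref S (start n)) = (blocks S n 0, []) := by
    intro n hn
    induction n, hn using Nat.le_induction with
    | base => simp [start, pref, lzState, blocks, block]
    | succ n hn ih =>
      have : ∀ a ≤ 2 ^ n, lzState (pref S (start n + a * n)) = (blocks S n a, []) := by
        intro a
        induction a with
        | zero => intro _; simpa using ih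
        | succ a iha => intro ha; exact next n a hn (by omega) (iha (by omega))
      rw [blocks_succ_zero, ← this _ le_rfl, start_succ, mul_comm]
  refine inner n a ha ?_ r hr
  clear hr
  induction a with
  | zero => simpa using outer n hn
  | succ a iha => exact next n a hn (by omega) (iha (by omega))

end IsZoned

end PPMLZ

namespace PPMLZ

open Finset Filter Topology

/-! ### The Lempel–Ziv ratio of a zoned sequence -/

lemma IsPointerCode.injective {c : ℕ → List Bool} (hc : IsPointerCode c) : Function.Injective c :=
  fun i j h => hc.prefixFree i j (h ▸ List.prefix_rfl)

/-- The constant `C` absorbs the finitely many indices at which the asymptotic bound may fail. -/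
lemma IsPointerCode.exists_bound {c : ℕ → List Bool} (hc : IsPointerCode c) {ε : ℝ} (hε : 0 < ε) :
    ∃ C : ℝ, 0 ≤ C ∧ ∀ n : ℕ, ∀ i < 2 ^ n, ((c i).length : ℝ) ≤ (1 + ε) * n + C := by
  obtain ⟨N, hN⟩ := eventually_atTop.1 (hc.efficient ε hε)
  refine ⟨∑ i ∈ range (N + 1), ((c i).length : ℝ), by positivity, fun n i hi => ?_⟩
  have hC : 0 ≤ ∑ i ∈ range (N + 1), ((c i).length : ℝ) := by positivity
  rcases lt_or_ge i (N + 1) with h | h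
  · have := single_le_sum (f := fun i => ((c i).length : ℝ)) (fun i _ => by positivity)
      (mem_range.2 h)
    have h2 : 0 ≤ (1 + ε) * n := by positivity
    linarith
  · have h1 := hN i (by omega)
    have h2 : Real.logb 2 i ≤ n := by
      rw [Real.logb_le_iff_le_rpow (by norm_num) (by exact_mod_cast (by omega : 0 < i)),
        Real.rpow_natCast]
      exact_mod_cast hi.le
    nlinarith

namespace IsZoned

variable {S : ℕ → Bool} {D : ℕ → ℕ → Bool}

lemma eventually_lz_ge (h : IsZoned S D) {c : ℕ → List Bool} (hc : Function.Injective c) {ε : ℝ}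
    (hε : 0 < ε) (hε1 : ε < 1) : ∀ᶠ m : ℕ in atTop, 1 - ε ≤ ((lz c (pref S m)).length : ℝ) / m := by
  -- The loss is `2 * δ` in the number of phrases, `δ` in the pointer length and `δ` in the estimate
  -- of `m`.
  obtain ⟨δ, hδ⟩ : ∃ δ, δ = ε / 4 := ⟨_, rfl⟩
  have hδ0 : 0 < δ := by linarith
  -- With this `ρ`, at most `δ * 2 ^ n` phrases have a pointer code shorter than `n - ρ`.
  obtain ⟨ρ, hρ⟩ := exists_pow_lt_of_lt_one (show 0 < δ / 2 by linarith)
    (show (1 / 2 : ℝ) < 1 by norm_num)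
  have ev1 : ∀ᶠ n : ℕ in atTop, (ρ : ℝ) ≤ δ * n :=
    (tendsto_natCast_atTop_atTop.const_mul_atTop hδ0).eventually_ge_atTop _
  have ev2 : ∀ᶠ n : ℕ in atTop, (2 : ℝ) ≤ δ * 2 ^ n :=
    ((tendsto_pow_atTop_atTop_of_one_lt (by norm_num)).const_mul_atTop hδ0).eventually_ge_atTop _
  obtain ⟨N, hN⟩ := eventually_atTop.1 (ev1.and (ev2.and (eventually_ge_atTop (ρ + 1))))
  filter_upwards [eventually_ge_atTop (start N), eventually_ge_atTop 1] with m hm hm1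
  obtain ⟨n, hn1, hn2, hn3⟩ := exists_zone m
  have hNn : N ≤ n := by
    by_contra hlt
    have := start_mono (show n + 1 ≤ N by omega)
    omega
  obtain ⟨h1, h2, h3⟩ := hN n hNn
  obtain ⟨i, rfl⟩ := Nat.exists_eq_add_of_le hn2
  rw [start_succ] at hn3
  have ha : i / n < 2 ^ n := Nat.div_lt_of_lt_mul (by omega)
  have hr : i % n < n := Nat.mod_lt _ hn1
  have hst := h.lzState_pref hn1 ha hr
  rw [add_assoc, Nat.div_add_mod'] at hst
  have hlow := lz_lower_bound hc (pref S (start n + i)) (n - ρ)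
  have hlen := length_blocks S n (i / n)
  rw [hst] at hlow
  simp only at hlow
  generalize hadef : i / n = a at *
  have him : i < (a + 1) * n := by
    have := Nat.div_add_mod' i n
    rw [hadef] at this
    nlinarith
  have hstart : start n ≤ n * 2 ^ n := by
    obtain ⟨k, rfl⟩ := Nat.exists_eq_add_of_le' hn1
    have := start_add_eq k
    have h2 : 2 ≤ 2 ^ (k + 1) := by rw [pow_succ]; have := Nat.one_le_two_pow (n := k); omega
    nlinarith
  have hp : 2 ≤ 2 ^ n := by
    calc 2 = 2 ^ 1 := rfl
      _ ≤ 2 ^ n := Nat.pow_le_pow_right (by norm_num) hn1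
  -- `K` is the number of complete phrases.
  obtain ⟨K, hK⟩ : ∃ K, 2 ^ n + a = K + 2 :=
    Nat.exists_eq_add_of_le' (hp.trans (Nat.le_add_right _ _))
  obtain ⟨l, hl⟩ : ∃ l, n = l + ρ := ⟨n - ρ, by omega⟩
  have hKlen : (blocks S n a).length - 1 = K := by omega
  rw [hKlen, show n - ρ = l by omega] at hlow
  have hlow' : (K : ℝ) * l ≤ ((lz c (pref S (start n + i))).length : ℝ) + 2 ^ (l + 1) * l := by
    exact_mod_cast hlow
  have hm' : ((start n + i : ℕ) : ℝ) ≤ n * (K + 3) := by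
    have : start n + i ≤ n * (K + 3) := by nlinarith
    exact_mod_cast this
  have hmpos : (0 : ℝ) < ((start n + i : ℕ) : ℝ) := by exact_mod_cast hm1
  rw [le_div_iff₀ hmpos]
  have hKr : (2 : ℝ) ^ n + a = K + 2 := by exact_mod_cast hK
  have hlr : (n : ℝ) = l + ρ := by exact_mod_cast hl
  have ha0 : (0 : ℝ) ≤ a := by positivity
  have hpow : (2 : ℝ) ^ (l + 1) ≤ δ * 2 ^ n := by
    have e : (2 : ℝ) ^ (l + 1) = 2 * (1 / 2) ^ ρ * 2 ^ n := by
      rw [hl, pow_add, pow_add, one_div, inv_pow]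
      field_simp
    have : (0 : ℝ) < 2 ^ n := by positivity
    rw [e]
    nlinarith
  set M : ℝ := 2 ^ n + a with hM
  have hM0 : (2 : ℝ) ^ n ≤ M := by linarith
  have hMpos : 0 < M := lt_of_lt_of_le (by positivity) hM0
  have hδM : δ * 2 ^ n ≤ δ * M := by gcongr
  have hn0 : (0 : ℝ) < n := by exact_mod_cast hn1
  have f1 : M * (1 - 2 * δ) ≤ K - 2 ^ (l + 1) := by linarith
  have f2 : n * (1 - δ) ≤ (l : ℝ) := by linarith
  have f3 : (K : ℝ) + 3 ≤ M * (1 + δ) := by linarith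
  have hl0 : (0 : ℝ) ≤ l := by positivity
  calc (1 - ε) * ((start n + i : ℕ) : ℝ) ≤ (1 - ε) * (n * (M * (1 + δ))) := by
        have : (0 : ℝ) < 1 - ε := by linarith
        have := hm'.trans (mul_le_mul_of_nonneg_left f3 hn0.le)
        gcongr
    _ = (n * M) * ((1 - ε) * (1 + δ)) := by ring
    _ ≤ (n * M) * ((1 - 2 * δ) * (1 - δ)) := by
        have : (1 - ε) * (1 + δ) ≤ (1 - 2 * δ) * (1 - δ) := by rw [hδ]; nlinarith
        gcongr
    _ = (M * (1 - 2 * δ)) * (n * (1 - δ)) := by ring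
    _ ≤ (K - 2 ^ (l + 1)) * l := by
        have : 0 ≤ 1 - δ := by linarith
        have h5 : 0 ≤ M * (1 - 2 * δ) := mul_nonneg hMpos.le (by linarith)
        exact mul_le_mul f1 f2 (by positivity) (h5.trans f1)
    _ ≤ _ := by linarith

/-- At the end of zone `n` there are fewer than `2 ^ (n + 1)` phrases, each of at most `(1 + ε / 2)
* (n + 1) + C + 1` bits, while the prefix has `(n - 1) * 2 ^ (n + 1) + 2` bits. -/
lemma frequently_lz_le (h : IsZoned S D) {c : ℕ → List Bool} (hc : IsPointerCode c) {ε : ℝ}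
    (hε : 0 < ε) : ∃ᶠ m : ℕ in atTop, ((lz c (pref S m)).length : ℝ) / m ≤ 1 + ε := by
  obtain ⟨C, hC0, hC⟩ := hc.exists_bound (show 0 < ε / 2 by linarith)
  have ev : ∀ᶠ n : ℕ in atTop, 5 + 2 * ε + C ≤ ε / 2 * n :=
    (tendsto_natCast_atTop_atTop.const_mul_atTop (by linarith)).eventually_ge_atTop _
  have : ∃ᶠ n : ℕ in atTop,
      ((lz c (pref S (start (n + 1)))).length : ℝ) / (start (n + 1) : ℕ) ≤ 1 + ε := by
    refine Eventually.frequently ?_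
    filter_upwards [ev, eventually_ge_atTop 2] with n hn hn2
    have hst := h.lzState_pref (n := n + 1) (a := 0) (r := 0) (by omega) (by positivity) (by omega)
    simp only [zero_mul, add_zero] at hst
    have hlen := length_blocks S (n + 1) 0
    have hup := lz_upper_bound (c := c) (x := pref S (start (n + 1)))
      (M := (1 + ε / 2) * ((n + 1 : ℕ) : ℝ) + C) (by positivity) (by
        intro i hi
        rw [hst] at hi
        exact hC (n + 1) i (by simp only at hi; omega))
    rw [hst] at hup
    have hl : ((blocks S (n + 1) 0).length : ℝ) ≤ 2 ^ (n + 1) := by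
      have : (blocks S (n + 1) 0).length ≤ 2 ^ (n + 1) := by omega
      exact_mod_cast this
    have hs : ((start (n + 1) : ℕ) : ℝ) + 2 ^ (n + 1) = n * 2 ^ (n + 1) + 2 := by
      exact_mod_cast start_add_eq n
    have hn2' : (2 : ℝ) ≤ n := by exact_mod_cast hn2
    have hp : (0 : ℝ) < 2 ^ (n + 1) := by positivity
    rw [div_le_iff₀ (by nlinarith)]
    refine hup.trans ?_
    push_cast
    calc ((blocks S (n + 1) 0).length : ℝ) * ((1 + ε / 2) * (n + 1) + C + 1)
        ≤ 2 ^ (n + 1) * ((1 + ε / 2) * (n + 1) + C + 1) := by gcongr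
      _ ≤ 2 ^ (n + 1) * ((1 + ε) * (n - 1)) := by
          gcongr
          linarith
      _ ≤ (1 + ε) * (start (n + 1) : ℕ) := by nlinarith
  have ht : Tendsto (fun n => start (n + 1)) atTop atTop :=
    tendsto_start.comp (tendsto_add_atTop_nat 1)
  exact ht.frequently this

theorem bestRatio_lz (h : IsZoned S D) {c : ℕ → List Bool} (hc : IsPointerCode c) :
    bestRatio (lz c) S = 1 := by
  refine le_antisymm ?_ ?_
  · refine EReal.le_of_forall_lt_iff_le.1 fun z hz => ?_
    have hz' : (1 : ℝ) < z := by exact_mod_cast hz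
    refine liminf_le_of_frequently_le ?_
    refine (h.frequently_lz_le hc (show 0 < z - 1 by linarith)).mono fun m hm => ?_
    rw [EReal.coe_le_coe_iff]
    linarith
  · refine EReal.ge_of_forall_gt_iff_ge.1 fun z hz => ?_
    have hz' : z < (1 : ℝ) := by exact_mod_cast hz
    refine le_liminf_of_le (by isBoundedDefault) ?_
    rcases le_or_gt z 0 with h0 | h0
    · refine Eventually.of_forall fun m => ?_
      rw [EReal.coe_le_coe_iff]
      exact h0.trans (by positivity)
    · filter_upwards [h.eventually_lz_ge hc.injective (show 0 < 1 - z by linarith)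
        (by linarith)] with m hm
      rw [EReal.coe_le_coe_iff]
      linarith

end IsZoned

end PPMLZ

namespace PPMLZ

open Finset

/-! ### Probabilities used by PPM* -/

/-- The probability with which the bit `b` is encoded if the listed contexts are still to be
tried. -/
def prob (x : List Bool) (b : Bool) : List (List Bool) → ℚ
  | [] => 1 / 2
  | w :: ws => if 0 < cnt x w b then cnt x w b / total x w else esc x w / total x w * prob x b ws

/-- The probability with which PPM* encodes the bit `b` after reading `x`. -/
def bitProb (x : List Bool) (b : Bool) : ℚ := prob x b (chain x)

lemma encodeIn_snd (x : List Bool) (b : Bool) (ws : List (List Bool)) (I : ℚ × ℚ) :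
    (encodeIn x b ws I).2 = I.2 * prob x b ws := by
  induction ws generalizing I with
  | nil => simp [encodeIn, prob, cut]
  | cons w ws ih =>
    rw [encodeIn, prob]
    by_cases hc : 0 < cnt x w b
    · simp [hc, cut]
    · rw [if_neg hc, if_neg hc, ih]; simp [cut, mul_assoc]

lemma finalInterval_append_singleton (x : List Bool) (b : Bool) :
    finalInterval (x ++ [b]) = encodeIn x b (chain x) (finalInterval x) := by
  have h : ∀ x : List Bool, (x.foldl (fun (p : List Bool × (ℚ × ℚ)) b =>
      (p.1 ++ [b], encodeIn p.1 b (chain p.1) p.2)) ([], ((0 : ℚ), (1 : ℚ)))).1 = x := by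
    intro x
    induction x using List.reverseRecOn with
    | nil => rfl
    | append_singleton x b ih => rw [List.foldl_append]; simp [ih]
  simp only [finalInterval, List.foldl_append, List.foldl_cons, List.foldl_nil, h]

lemma finalInterval_pref_snd (S : ℕ → Bool) (m : ℕ) :
    (finalInterval (pref S m)).2 = ∏ i ∈ range m, bitProb (pref S i) (S i) := by
  induction m with
  | zero => simp [pref, finalInterval]
  | succ m ih =>
    rw [pref_succ, finalInterval_append_singleton, encodeIn_snd, ih, prod_range_succ, bitProb]

/-- One bit is lost by rounding the inverse width up to an integer, another by rounding its
logarithm. -/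
lemma length_ppmStar_le {x : List Bool} (h0 : 0 < (finalInterval x).2)
    (h1 : (finalInterval x).2 ≤ 1) :
    ((ppmStar x).length : ℝ) ≤ -Real.logb 2 ((finalInterval x).2 : ℝ) + 2 := by
  have hl : (ppmStar x).length = Nat.clog 2 ⌈(finalInterval x).2⁻¹⌉₊ := by simp [ppmStar]
  rw [hl]
  set y := (finalInterval x).2⁻¹ with hy
  have hy1 : 1 ≤ y := (one_le_inv₀ h0).2 h1
  have hN : (⌈y⌉₊ : ℝ) ≤ 2 * (y : ℝ) := by
    have h2 : (⌈y⌉₊ : ℚ) < y + 1 := Nat.ceil_lt_add_one (by linarith)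
    have : (⌈y⌉₊ : ℚ) ≤ 2 * y := by linarith
    exact_mod_cast this
  have hN1 : (1 : ℝ) ≤ (⌈y⌉₊ : ℝ) := by exact_mod_cast Nat.one_le_ceil_iff.2 (by linarith)
  have hyr : (1 : ℝ) ≤ (y : ℝ) := by exact_mod_cast hy1
  rw [← Real.natCeil_logb_natCast]
  have h3 := (Nat.ceil_lt_add_one (Real.logb_nonneg (b := 2) (by norm_num) hN1)).le
  have h4 : Real.logb 2 (⌈y⌉₊ : ℝ) ≤ 1 + Real.logb 2 (y : ℝ) := by
    refine (Real.logb_le_logb_of_le (by norm_num) (by linarith) hN).trans ?_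
    rw [Real.logb_mul (by norm_num) (by linarith), Real.logb_self_eq_one (by norm_num)]
  have h5 : Real.logb 2 (y : ℝ) = -Real.logb 2 ((finalInterval x).2 : ℝ) := by
    rw [hy, Rat.cast_inv, Real.logb_inv]
  push_cast at h3 ⊢
  linarith

/-! ### Contexts -/

lemma occ_le_of_prefix {v w : List Bool} (h : v <+: w) (x : List Bool) : occ w x ≤ occ v x :=
  card_le_card (monotone_filter_right _ fun _ _ hi => h.trans hi)

lemma occ_le_of_suffix {v w : List Bool} (h : v <:+ w) (x : List Bool) : occ w x ≤ occ v x := by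
  obtain ⟨a, rfl⟩ := h
  refine card_le_card_of_injOn (fun i => i + a.length) ?_ fun i _ j _ hij => by simpa using hij
  intro i hi
  simp only [coe_filter, mem_range, Set.mem_ofPred_eq] at hi ⊢
  obtain ⟨t, ht⟩ := hi.2
  have hv : v <+: x.drop (i + a.length) := by
    refine ⟨t, ?_⟩
    rw [← List.drop_drop, ← ht, List.append_assoc, List.drop_left]
  refine ⟨?_, hv⟩
  have := congrArg List.length ht
  simp at this
  omega

lemma cnt_le_of_suffix {v w : List Bool} (h : v <:+ w) (x : List Bool) (b : Bool) :
    cnt x w b ≤ cnt x v b := by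
  obtain ⟨a, rfl⟩ := h
  exact occ_le_of_suffix ⟨a, by simp⟩ x

lemma dropLast_suffix {v w : List Bool} (h : v <:+ w) (hv : v ≠ []) :
    v.dropLast <:+ w.dropLast := by
  obtain ⟨a, rfl⟩ := h
  rw [List.dropLast_append_of_ne_nil hv]
  exact List.suffix_append _ _

/-- This closure makes the relevant contexts exactly the suffixes of the longest one. -/
lemma InModel.of_suffix {x v w : List Bool} (hw : InModel x w) (h : v <:+ w) : InModel x v := by
  refine ⟨?_, ?_⟩
  · by_cases hv : v = []
    · exact Or.inl hv
    · refine Or.inr ?_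
      rcases hw.1 with rfl | hw1
      · exact absurd (List.suffix_nil.1 h) hv
      · exact hw1.trans (occ_le_of_suffix (dropLast_suffix h hv) x)
  · exact hw.2.trans_le (Nat.add_le_add (cnt_le_of_suffix h x _) (cnt_le_of_suffix h x _))

lemma one_le_esc {x w : List Bool} (h : InModel x w) : 1 ≤ esc x w := by
  have := h.2
  unfold esc
  split_ifs <;> omega

lemma esc_le_two (x w : List Bool) : esc x w ≤ 2 := by
  unfold esc
  split_ifs <;> omega

lemma cnt_pos_of_esc_ne_one {x w : List Bool} (h : InModel x w) (he : esc x w ≠ 1) (b : Bool) :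
    0 < cnt x w b := by
  have := h.2
  unfold esc at he
  split_ifs at he <;> cases b <;> omega

lemma esc_ne_one {x w : List Bool} (h : ∀ b, 0 < cnt x w b) : esc x w ≠ 1 := by
  simp [esc, h]

lemma filter_tails {P : List Bool → Prop} [DecidablePred P]
    (hP : ∀ v w : List Bool, v <:+ w → P w → P v) (x : List Bool) :
    x.tails.filter (fun w => P w) = [] ∨
      ∃ u, u <:+ x ∧ P u ∧ x.tails.filter (fun w => P w) = u.tails := by
  induction x with
  | nil =>
    by_cases h : P []
    · exact Or.inr ⟨[], List.suffix_rfl, h, by simp [h]⟩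
    · exact Or.inl (by simp [h])
  | cons a x ih =>
    by_cases h : P (a :: x)
    · refine Or.inr ⟨a :: x, List.suffix_rfl, h, List.filter_eq_self.2 fun w hw => ?_⟩
      simpa using hP w _ ((List.mem_tails _ _).1 hw) h
    · rw [List.tails_cons, List.filter_cons_of_neg (by simpa using h)]
      rcases ih with ih | ⟨u, h1, h2, h3⟩
      · exact Or.inl ih
      · exact Or.inr ⟨u, h1.trans (List.suffix_cons a x), h2, h3⟩

lemma filter_tails_length {u w : List Bool} (h : w <:+ u) :
    u.tails.filter (fun v => v.length ≤ w.length) = w.tails := by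
  induction u with
  | nil => rw [List.suffix_nil.1 h]; simp
  | cons a u ih =>
    rcases List.suffix_cons_iff.1 h with rfl | h'
    · exact List.filter_eq_self.2 fun v hv => by simpa using ((List.mem_tails _ _).1 hv).length_le
    · have := h'.length_le
      rw [List.tails_cons, List.filter_cons_of_neg (by simp; omega), ih h']

lemma pairwise_tails (u : List Bool) : u.tails.Pairwise fun a b => b.length < a.length := by
  induction u with
  | nil => simp
  | cons a u ih =>
    rw [List.tails_cons, List.pairwise_cons]
    refine ⟨fun b hb => ?_, ih⟩
    have := ((List.mem_tails _ _).1 hb).length_le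
    simp; omega

lemma mem_relevant {x w : List Bool} : w ∈ relevant x ↔ w <:+ x ∧ InModel x w := by
  simp [relevant]

lemma exists_chain_eq {x : List Bool} (hx : relevant x ≠ []) :
    ∃ w, w <:+ x ∧ InModel x w ∧ chain x = w.tails ∧
      ((esc x w = 1 ∧ ∀ v, v <:+ x → InModel x v → esc x v = 1 → w <:+ v) ∨
        ∀ v, v <:+ x → InModel x v → v <:+ w ∧ esc x v ≠ 1) := by
  obtain ⟨u, hu1, hu2, hu⟩ := (filter_tails (P := fun w => InModel x w)
    (fun v w h hw => hw.of_suffix h) x).resolve_left hx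
  have hu' : relevant x = u.tails := hu
  unfold chain
  split
  · rename_i w hw
    have hmem := List.mem_of_find?_eq_some hw
    rw [List.mem_reverse, mem_relevant] at hmem
    rw [List.find?_eq_some_iff_append] at hw
    obtain ⟨he, as, bs, hab, has⟩ := hw
    have he' : esc x w = 1 := by simpa using he
    have hwu : w <:+ u := by
      rw [← List.mem_tails, ← hu']; exact mem_relevant.2 hmem
    refine ⟨w, hmem.1, hmem.2, by rw [hu', filter_tails_length hwu], Or.inl ⟨he', ?_⟩⟩
    intro v hv1 hv2 hv3
    have hv : v ∈ (relevant x).reverse := List.mem_reverse.2 (mem_relevant.2 ⟨hv1, hv2⟩)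
    -- The reversed list has increasing lengths, so the first hit is the shortest deterministic
    -- context.
    have hp := List.pairwise_reverse.2 (hu' ▸ pairwise_tails u)
    rw [hab] at hv hp
    rcases List.mem_append.1 hv with h | h
    · have := has v h
      simp [hv3] at this
    · rcases List.mem_cons.1 h with rfl | h
      · exact List.suffix_rfl
      · have := (List.pairwise_cons.1 (List.pairwise_append.1 hp).2.1).1 v h
        exact List.suffix_of_suffix_length_le hmem.1 hv1 this.le
  · rename_i hnone
    refine ⟨u, hu1, hu2, hu', Or.inr fun v hv1 hv2 => ⟨?_, ?_⟩⟩
    · rw [← List.mem_tails, ← hu']; exact mem_relevant.2 ⟨hv1, hv2⟩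
    · rw [List.find?_eq_none] at hnone
      simpa using hnone v (List.mem_reverse.2 (mem_relevant.2 ⟨hv1, hv2⟩))

lemma prob_pos_le_one {x : List Bool} (b : Bool) {ws : List (List Bool)}
    (h : ∀ w ∈ ws, InModel x w) : 0 < prob x b ws ∧ prob x b ws ≤ 1 := by
  induction ws with
  | nil => norm_num [prob]
  | cons w ws ih =>
    obtain ⟨i1, i2⟩ := ih fun v hv => h v (List.mem_cons_of_mem _ hv)
    have he := one_le_esc (h w List.mem_cons_self)
    have ht : 0 < total x w := by unfold total; omega
    have ht' : (0 : ℚ) < total x w := by exact_mod_cast ht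
    have e1 : (0 : ℚ) < esc x w := by exact_mod_cast he
    have e2 : (esc x w : ℚ) ≤ total x w := by
      exact_mod_cast (by unfold total; omega : esc x w ≤ total x w)
    have e3 : (cnt x w b : ℚ) ≤ total x w := by
      exact_mod_cast (by unfold total; cases b <;> omega : cnt x w b ≤ total x w)
    rw [prob]
    split_ifs with hc
    · have : (0 : ℚ) < cnt x w b := by exact_mod_cast hc
      exact ⟨by positivity, (div_le_one ht').2 e3⟩
    · exact ⟨by positivity, mul_le_one₀ ((div_le_one ht').2 e2) i1.le i2⟩

lemma inModel_of_mem_chain {x w : List Bool} (h : w ∈ chain x) : InModel x w := by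
  by_cases hx : relevant x = []
  · unfold chain at h
    rw [hx] at h
    simp at h
  · obtain ⟨u, -, hu, hc, -⟩ := exists_chain_eq hx
    rw [hc, List.mem_tails] at h
    exact hu.of_suffix h

lemma bitProb_pos (x : List Bool) (b : Bool) : 0 < bitProb x b :=
  (prob_pos_le_one b fun _ => inModel_of_mem_chain).1

lemma bitProb_le_one (x : List Bool) (b : Bool) : bitProb x b ≤ 1 :=
  (prob_pos_le_one b fun _ => inModel_of_mem_chain).2

lemma exists_tails_eq_cons (w : List Bool) : ∃ ws, w.tails = w :: ws := by
  cases w with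
  | nil => exact ⟨[], rfl⟩
  | cons a w => exact ⟨w.tails, rfl⟩

/-- A deterministic suffix makes the predicted bit cheap. -/
lemma bitProb_ge_of_deterministic {x u : List Bool} {b : Bool} {k : ℕ} (hk : 1 ≤ k) (hu : u <:+ x)
    (hm : InModel x u) (he : esc x u = 1) (hc : k ≤ cnt x u b) :
    (k : ℚ) / (k + 1) ≤ bitProb x b := by
  obtain ⟨w, hw1, hw2, hw3, hw4⟩ :=
    exists_chain_eq (List.ne_nil_of_mem (mem_relevant.2 ⟨hu, hm⟩))
  rcases hw4 with ⟨he1, hmin⟩ | hall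
  · have hck := hc.trans (cnt_le_of_suffix (hmin u hu hm he) x b)
    have htot : total x w = cnt x w b + 1 := by
      unfold total
      rw [he1]
      unfold esc at he1
      split_ifs at he1 <;> cases b <;> omega
    obtain ⟨ws, hws⟩ := exists_tails_eq_cons w
    rw [bitProb, hw3, hws, prob, if_pos (by omega), htot]
    have : (k : ℚ) ≤ cnt x w b := by exact_mod_cast hck
    push_cast
    rw [div_le_div_iff₀ (by positivity) (by positivity)]
    nlinarith
  · exact absurd he (hall u hu hm).2

/-- If both bits have followed the suffix `v`, then there is at most one escape. -/
lemma bitProb_ge_of_cnt_pos {x v : List Bool} {Q : ℕ} (b : Bool) (hv : v <:+ x) (hm : InModel x v)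
    (hpos : ∀ b, 0 < cnt x v b) (hQ : ∀ u : List Bool, v.length ≤ u.length → occ u x ≤ Q) :
    1 / (2 * Q + 2 : ℚ) ^ 2 ≤ bitProb x b := by
  have htot : ∀ w, v.length ≤ w.length → (total x w : ℚ) ≤ 2 * Q + 2 := by
    intro w hw
    have h1 : cnt x w false ≤ Q := hQ _ (by simp; omega)
    have h2 : cnt x w true ≤ Q := hQ _ (by simp; omega)
    have h3 := esc_le_two x w
    have : total x w ≤ 2 * Q + 2 := by unfold total; omega
    exact_mod_cast this
  have htpos : ∀ w, InModel x w → (0 : ℚ) < total x w := by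
    intro w hw
    have := one_le_esc hw
    exact_mod_cast (by unfold total; omega : 0 < total x w)
  have hfrac : ∀ (w : List Bool) (k : ℕ), v.length ≤ w.length → InModel x w → 0 < k →
      1 / (2 * Q + 2 : ℚ) ≤ k / total x w := by
    intro w k hw hm hk
    have : (1 : ℚ) ≤ k := by exact_mod_cast hk
    exact div_le_div₀ (by positivity) this (htpos w hm) (htot w hw)
  have hone : 1 / (2 * Q + 2 : ℚ) ≤ 1 := by
    rw [div_le_one (by positivity)]
    have : (0 : ℚ) ≤ Q := by positivity
    linarith
  have hsq : 1 / (2 * Q + 2 : ℚ) ^ 2 ≤ 1 / (2 * Q + 2 : ℚ) := by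
    rw [sq, ← one_div_mul_one_div]
    exact mul_le_of_le_one_left (by positivity) hone
  have hve : ∀ u, u <:+ v → esc x u ≠ 1 := fun u hu =>
    esc_ne_one fun b => (hpos b).trans_le (cnt_le_of_suffix hu x b)
  obtain ⟨w, hw1, hw2, hw3, hw4⟩ :=
    exists_chain_eq (List.ne_nil_of_mem (mem_relevant.2 ⟨hv, hm⟩))
  rw [bitProb, hw3]
  rcases hw4 with ⟨he1, hmin⟩ | hall
  · have hnot : ¬ w <:+ v := fun h => hve w h he1
    have hvw : v.length < w.length := by
      by_contra hlt
      exact hnot (List.suffix_of_suffix_length_le hw1 hv (not_lt.1 hlt))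
    cases w with
    | nil => simp at hvw
    | cons a w =>
      simp only [List.length_cons] at hvw
      have hs : w <:+ a :: w := List.suffix_cons a w
      have hw' := hw2.of_suffix hs
      -- Minimality of the starting context `a :: w`: the next shorter one is not deterministic, so
      -- it has seen both bits and a second escape is impossible.
      have he' : esc x w ≠ 1 := fun h => by
        have := (hmin w (hs.trans hw1) hw' h).length_le
        simp at this
      obtain ⟨ws, hws⟩ := exists_tails_eq_cons w
      rw [List.tails_cons, prob]
      split_ifs with hc
      · exact hsq.trans (hfrac _ _ (by simp; omega) hw2 hc)
      · rw [hws, prob, if_pos (cnt_pos_of_esc_ne_one hw' he' b), sq, ← one_div_mul_one_div]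
        exact mul_le_mul (hfrac _ _ (by simp; omega) hw2 (one_le_esc hw2))
          (hfrac _ _ (by omega) hw' (cnt_pos_of_esc_ne_one hw' he' b)) (by positivity)
          (by positivity)
  · obtain ⟨ws, hws⟩ := exists_tails_eq_cons w
    have hc := cnt_pos_of_esc_ne_one hw2 (hall w hw1 hw2).2 b
    rw [hws, prob, if_pos hc]
    exact hsq.trans (hfrac _ _ (hall v hv hm).1.length_le hw2 hc)

/-- The number of bits that PPM* needs for bit `i` of `S`. -/
noncomputable def cost (S : ℕ → Bool) (i : ℕ) : ℝ := -Real.logb 2 (bitProb (pref S i) (S i) : ℝ)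

lemma cost_nonneg (S : ℕ → Bool) (i : ℕ) : 0 ≤ cost S i := by
  have h1 : (0 : ℝ) < bitProb (pref S i) (S i) := by exact_mod_cast bitProb_pos _ _
  have h2 : (bitProb (pref S i) (S i) : ℝ) ≤ 1 := by exact_mod_cast bitProb_le_one _ _
  exact neg_nonneg.2 (Real.logb_nonpos (by norm_num) h1.le h2)

lemma cost_le {S : ℕ → Bool} {i : ℕ} {p : ℚ} (hp : 0 < p) (h : p ≤ bitProb (pref S i) (S i)) :
    cost S i ≤ -Real.logb 2 (p : ℝ) :=
  neg_le_neg (Real.logb_le_logb_of_le (by norm_num) (by exact_mod_cast hp) (by exact_mod_cast h))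

lemma length_ppmStar_pref_le (S : ℕ → Bool) (m : ℕ) :
    ((ppmStar (pref S m)).length : ℝ) ≤ ∑ i ∈ range m, cost S i + 2 := by
  have e := finalInterval_pref_snd S m
  refine (length_ppmStar_le ?_ ?_).trans (add_le_add_left (le_of_eq ?_) _)
  · rw [e]; exact prod_pos fun i _ => bitProb_pos _ _
  · rw [e]; exact prod_le_one (fun i _ => (bitProb_pos _ _).le) fun i _ => bitProb_le_one _ _
  · rw [e, Rat.cast_prod, Real.logb_prod, ← sum_neg_distrib]
    · rfl
    · intro i _
      exact_mod_cast (bitProb_pos (pref S i) (S i)).ne'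

end PPMLZ

namespace PPMLZ

open Finset

/-! ### Every bit is cheap -/

lemma sum_range_start {M : Type*} [AddCommMonoid M] (f : ℕ → M) (n : ℕ) :
    ∑ p ∈ range (start n), f p =
      ∑ k ∈ range n, ∑ j ∈ range k, ∑ r ∈ range (2 ^ k), f (start k + j * 2 ^ k + r) := by
  have hz : ∀ k m, ∑ i ∈ range (m * 2 ^ k), f (start k + i) =
      ∑ j ∈ range m, ∑ r ∈ range (2 ^ k), f (start k + j * 2 ^ k + r) := by
    intro k m
    induction m with
    | zero => simp
    | succ m ih => rw [Nat.succ_mul, sum_range_add, ih, sum_range_succ]; simp only [add_assoc]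
  induction n with
  | zero => simp [start]
  | succ n ih => rw [start_succ, sum_range_add, ih, sum_range_succ, hz]

lemma exists_copy {n p : ℕ} (hp : p < start (n + 1)) :
    ∃ k j r, 1 ≤ k ∧ k ≤ n ∧ j < k ∧ r < 2 ^ k ∧ p = start k + j * 2 ^ k + r := by
  obtain ⟨k, hk1, hk2, hk3⟩ := exists_zone p
  obtain ⟨i, rfl⟩ := Nat.exists_eq_add_of_le hk2
  rw [start_succ] at hk3
  refine ⟨k, i / 2 ^ k, i % 2 ^ k, hk1, ?_, Nat.div_lt_of_lt_mul (by rw [mul_comm]; omega),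
    Nat.mod_lt _ (by positivity), by rw [add_assoc, Nat.div_add_mod']⟩
  by_contra hlt
  have := start_mono (show n + 1 ≤ k by omega)
  omega

lemma cnt_add_cnt_le (x w : List Bool) : cnt x w false + cnt x w true ≤ occ w x := by
  unfold cnt occ
  rw [← card_union_of_disjoint]
  · refine card_le_card fun i hi => ?_
    rw [mem_union, mem_filter, mem_filter] at hi
    rw [mem_filter]
    rcases hi with hi | hi <;> exact ⟨hi.1, (List.prefix_append _ _).trans hi.2⟩
  · rw [disjoint_filter]
    intro i _ h1 h2
    have := (List.prefix_of_prefix_length_le h1 h2 (by simp)).eq_of_length (by simp)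
    simp at this

lemma win_suffix_pref (S : ℕ → Bool) {i l : ℕ} (h : l ≤ i) : win S (i - l) l <:+ pref S i := by
  refine ⟨win S 0 (i - l), ?_⟩
  conv_rhs => rw [pref_eq_win, ← Nat.sub_add_cancel h, win_add, zero_add]

/-- The bound for the cost of an arbitrary bit of zone `n`. -/
noncomputable def maxCost (n : ℕ) : ℝ := 2 * Real.logb 2 (2 * (n + 2) ^ 3 + 2)

lemma maxCost_nonneg (n : ℕ) : 0 ≤ maxCost n := by
  refine mul_nonneg (by norm_num) (Real.logb_nonneg (by norm_num) ?_)
  have : (0 : ℝ) ≤ 2 * (n + 2) ^ 3 := by positivity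
  linarith

/-- The windows of length `L` that start before position `N`. -/
def windows (S : ℕ → Bool) (N L : ℕ) : Finset (List Bool) := (range N).image fun p => win S p L

lemma mem_windows {S : ℕ → Bool} {N L : ℕ} {u : List Bool} :
    u ∈ windows S N L ↔ ∃ p < N, win S p L = u := by simp [windows]

/-- The windows of length `L` that are followed by both bits. -/
def rightSpecial (S : ℕ → Bool) (N L : ℕ) : Finset (List Bool) :=
  {u ∈ windows S N L | ∀ b, u ++ [b] ∈ windows S N (L + 1)}

/-- Every window extends to a window one bit longer, and the right special ones do so in two ways.
-/
lemma card_windows_add_card_rightSpecial_le (S : ℕ → Bool) (N L : ℕ) :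
    #(windows S N L) + #(rightSpecial S N L) ≤ #(windows S N (L + 1)) := by
  let A : Bool → Finset (List Bool) := fun b => {u ∈ windows S N L | u ++ [b] ∈ windows S N (L + 1)}
  have h1 : windows S N L ⊆ A false ∪ A true := by
    intro u hu
    obtain ⟨p, hp, rfl⟩ := mem_windows.1 hu
    have : win S p L ++ [S (p + L)] ∈ windows S N (L + 1) :=
      mem_windows.2 ⟨p, hp, win_succ _ _ _⟩
    simp only [A, mem_union, mem_filter]
    cases hb : S (p + L) <;> rw [hb] at this
    · exact Or.inl ⟨hu, this⟩
    · exact Or.inr ⟨hu, this⟩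
  have h2 : rightSpecial S N L ⊆ A false ∩ A true := by
    intro u hu
    rw [rightSpecial, mem_filter] at hu
    simp only [A, mem_inter, mem_filter]
    exact ⟨⟨hu.1, hu.2 false⟩, ⟨hu.1, hu.2 true⟩⟩
  have hcard : ∀ b, #((A b).image (· ++ [b])) = #(A b) := fun b =>
    card_image_of_injective _ fun u v huv => List.append_left_injective [b] huv
  have h3 : #((A false).image (· ++ [false]) ∪ (A true).image (· ++ [true])) ≤
      #(windows S N (L + 1)) := by
    refine card_le_card (union_subset ?_ ?_) <;>
    · intro w hw
      obtain ⟨u, hu, rfl⟩ := mem_image.1 hw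
      exact (mem_filter.1 hu).2
  rw [card_union_of_disjoint, hcard, hcard, ← card_union_add_card_inter] at h3
  · exact (Nat.add_le_add (card_le_card h1) (card_le_card h2)).trans h3
  · rw [disjoint_left]
    intro w h1 h2
    obtain ⟨u, -, rfl⟩ := mem_image.1 h1
    obtain ⟨v, -, hv⟩ := mem_image.1 h2
    have := (List.append_inj' hv rfl).2
    simp at this

/-- The increments of the number of windows between lengths `n` and `2 * n` telescope, and the
smallest of the `n` terms is at most their average. -/
lemma exists_rightSpecial_card_le (S : ℕ → Bool) (N : ℕ) {n : ℕ} (hn : 1 ≤ n) :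
    ∃ L, n ≤ L ∧ L ≤ 2 * n ∧ n * #(rightSpecial S N L) ≤ #(windows S N (2 * n)) := by
  have htel : ∀ M, ∑ l ∈ range M, #(rightSpecial S N (n + l)) ≤ #(windows S N (n + M)) := by
    intro M
    induction M with
    | zero => simp
    | succ M ih =>
      rw [sum_range_succ]
      have := card_windows_add_card_rightSpecial_le S N (n + M)
      rw [← add_assoc]
      omega
  obtain ⟨l, hl, hmin⟩ := exists_min_image (range n) (fun l => #(rightSpecial S N (n + l)))
    ⟨0, mem_range.2 hn⟩
  refine ⟨n + l, by omega, by have := mem_range.1 hl; omega, ?_⟩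
  have := card_nsmul_le_sum (range n) (fun l => #(rightSpecial S N (n + l))) _ hmin
  rw [card_range, smul_eq_mul] at this
  rw [two_mul]
  exact this.trans (htel n)

namespace IsZoned

variable {S : ℕ → Bool} {D : ℕ → ℕ → Bool}

/-- Zone `n - 1` is complete, and its blocks are all strings of length `n - 1`; a shorter `w` is
padded. -/
lemma occ_pos (h : IsZoned S D) {n i : ℕ} (hi : start n ≤ i) {w : List Bool} (hw : w.length < n) :
    0 < occ w (pref S i) := by
  obtain ⟨k, rfl⟩ := Nat.exists_eq_add_of_le' (Nat.one_le_of_lt hw)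
  have hl : (w ++ List.replicate (k - w.length) false).length = k := by simp; omega
  refine lt_of_lt_of_le ?_ (occ_le_of_prefix (List.prefix_append w (List.replicate (k - w.length) false)) _)
  obtain ⟨a, ha, hav⟩ := h.exists_block_eq hl
  rw [occ_pref, card_pos, hl]
  have h1 : (a + 1) * k ≤ 2 ^ k * k := Nat.mul_le_mul_right k ha
  have h2 := start_succ k
  have h3 : start k + a * k + k ≤ i := by nlinarith
  exact ⟨start k + a * k, mem_filter.2 ⟨mem_range.2 (by omega), h3, hav⟩⟩

/-- Each copy contributes at most 4 occurrences from the period and `v.length` at its boundary, and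
there are fewer than `(n + 2) ^ 2` copies. -/
lemma card_win_start_le (h : IsZoned S D) {n : ℕ} {v : List Bool} (hv : v.length + 2 = n) :
    #{p ∈ range (start (n + 1)) | win S p v.length = v} ≤ (n + 2) ^ 3 := by
  rw [card_filter, sum_range_start]
  have hcopy : ∀ k ∈ range (n + 1), ∀ j ∈ range k,
      ∑ r ∈ range (2 ^ k), (if win S (start k + j * 2 ^ k + r) v.length = v then 1 else 0) ≤
        n + 2 := by
    intro k hk j hj
    rw [mem_range] at hk hj
    rw [← card_filter]
    have h1 := (h.card_copy (n := k) (by omega) hj v).1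
    have h2 := h.card_win_le_four (n := k) (by omega) v (by omega)
    omega
  calc _ ≤ ∑ k ∈ range (n + 1), ∑ j ∈ range k, (n + 2) :=
        sum_le_sum fun k hk => sum_le_sum fun j hj => hcopy k hk j hj
    _ ≤ ∑ k ∈ range (n + 1), (n + 2) * (n + 2) := by
        refine sum_le_sum fun k hk => ?_
        rw [sum_const, card_range, smul_eq_mul]
        have := mem_range.1 hk
        exact Nat.mul_le_mul_right _ (by omega)
    _ ≤ (n + 2) ^ 3 := by
        rw [sum_const, card_range, smul_eq_mul, pow_succ, sq, mul_comm]
        exact Nat.mul_le_mul_left _ (by omega)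

lemma occ_le (h : IsZoned S D) {n i : ℕ} (hn : 3 ≤ n) (hi : i < start (n + 1)) {u : List Bool}
    (hu : n ≤ u.length + 2) : occ u (pref S i) ≤ (n + 2) ^ 3 := by
  have hl : (u.take (n - 2)).length + 2 = n := by rw [List.length_take]; omega
  refine (occ_le_of_prefix (List.take_prefix (n - 2) u) _).trans
    (le_trans ?_ (h.card_win_start_le hl))
  rw [occ_pref]
  refine card_le_card fun p hp => ?_
  simp only [mem_filter, mem_range] at hp ⊢
  exact ⟨by omega, hp.2.2⟩

/-- The context of length `n - 2` is short enough to have been followed by both bits, as all strings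
of length `n - 1` have occurred, and long enough for polynomially bounded counts. -/
lemma cost_le_maxCost (h : IsZoned S D) {n i : ℕ} (hn : 3 ≤ n) (hi : start n ≤ i)
    (hi' : i < start (n + 1)) : cost S i ≤ maxCost n := by
  have hni : n ≤ i := by
    refine le_trans ?_ hi
    obtain ⟨k, rfl⟩ := Nat.exists_eq_add_of_le' (show 1 ≤ n by omega)
    have h1 := start_succ k
    have h2 : 2 ^ 2 ≤ 2 ^ k := Nat.pow_le_pow_right (by norm_num) (by omega)
    nlinarith
  set v := win S (i - (n - 2)) (n - 2) with hv
  have hvl : v.length = n - 2 := by simp [hv]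
  have hpos : ∀ w : List Bool, w.length + 1 < n → ∀ b, 0 < cnt (pref S i) w b := fun w hw b =>
    h.occ_pos hi (by simpa using hw)
  have hm : InModel (pref S i) v := by
    have hd : v.dropLast.length + 1 < n := by rw [List.length_dropLast]; omega
    have hv' : v.length + 1 < n := by omega
    refine ⟨Or.inr (le_trans ?_ (cnt_add_cnt_le _ _)), ?_⟩
    · have h1 := hpos _ hd false
      have h2 := hpos _ hd true
      omega
    · have h1 := hpos _ hv' false
      omega
  have key := bitProb_ge_of_cnt_pos (Q := (n + 2) ^ 3) (S i) (win_suffix_pref S (by omega)) hm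
    (hpos v (by omega)) fun u hu => h.occ_le hn hi' (by rw [length_win] at hu; omega)
  refine (cost_le (by positivity) key).trans (le_of_eq ?_)
  push_cast
  rw [one_div, Real.logb_inv, neg_neg, Real.logb_pow, maxCost]
  norm_num

/-! ### Most bits are very cheap -/

/-- A window inside a copy of zone `k` is one of the `2 ^ k` windows of the period. At most `L`
starting positions per copy give windows that leave it. -/
lemma card_windows_le (h : IsZoned S D) (n L : ℕ) :
    #(windows S (start (n + 1)) L) ≤ 2 ^ (n + 1) + (n + 1) ^ 2 * L := by
  let A : ℕ → Finset (List Bool) := fun k => (range (2 ^ k)).image (fun r => win (D k) r L) ∪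
    (range k).biUnion fun j =>
      (Ico (2 ^ k - L) (2 ^ k)).image fun r => win S (start k + j * 2 ^ k + r) L
  have hsub : windows S (start (n + 1)) L ⊆ (range (n + 1)).biUnion A := by
    intro u hu
    obtain ⟨p, hp, rfl⟩ := mem_windows.1 hu
    obtain ⟨k, j, r, hk1, hk2, hj, hr, rfl⟩ := exists_copy hp
    refine mem_biUnion.2 ⟨k, mem_range.2 (by omega), mem_union.2 ?_⟩
    by_cases hrL : r + L ≤ 2 ^ k
    · left
      rw [h.win_copy hk1 hj hrL, ← h.win_mod hk1]
      exact mem_image_of_mem (fun r => win (D k) r L)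
        (mem_range.2 (Nat.mod_lt _ (by positivity)))
    · right
      exact mem_biUnion.2 ⟨j, mem_range.2 hj, mem_image_of_mem
        (fun r => win S (start k + j * 2 ^ k + r) L) (mem_Ico.2 ⟨by omega, hr⟩)⟩
  have hA : ∀ k ∈ range (n + 1), #(A k) ≤ 2 ^ k + (n + 1) * L := by
    intro k hk
    refine (card_union_le _ _).trans (Nat.add_le_add (card_image_le.trans (by simp)) ?_)
    refine (card_biUnion_le_card_mul _ _ L fun j _ => card_image_le.trans ?_).trans ?_
    · rw [Nat.card_Ico]; omega
    · rw [card_range]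
      exact Nat.mul_le_mul_right _ (mem_range.1 hk).le
  refine (card_le_card hsub).trans (card_biUnion_le.trans ((sum_le_sum hA).trans ?_))
  rw [sum_add_distrib, sum_const, card_range, smul_eq_mul, ← mul_assoc, ← sq]
  exact Nat.add_le_add_right (Nat.geomSum_lt le_rfl fun k hk => mem_range.1 hk).le _

/-- The last `L` bits and the bit to be encoded have occurred together in each of the `j` earlier
copies. The other bit never follows this context before the end of the zone, or the context would be
right special. So it is deterministic with count at least `j`. -/
lemma cost_le_of_not_mem_rightSpecial (h : IsZoned S D) {n j r L : ℕ} (hn : 1 ≤ n) (hj1 : 1 ≤ j)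
    (hj : j < n) (hL : 1 ≤ L) (hLr : L ≤ r) (hr : r + n ≤ 2 ^ n)
    (hu : win S (start n + j * 2 ^ n + r - L) L ∉ rightSpecial S (start (n + 1)) L) :
    cost S (start n + j * 2 ^ n + r) ≤ Real.logb 2 (j + 1 : ℕ) - Real.logb 2 j := by
  set i := start n + j * 2 ^ n + r with hi
  set u := win S (i - L) L with hudef
  set t := reps n
  have hul : u.length = L := by simp [hudef]
  have hjt : j / t < n := div_reps_lt hj
  have hdiv : ∀ j' ≤ j, j' / t ≤ j / t := fun j' hj' => Nat.div_le_div_right hj'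
  have hub : u ++ [S i] = win S (i - L) (L + 1) := by
    rw [win_succ, Nat.sub_add_cancel (by omega)]
  -- The place in copy `j'` of the window at `r - L` in copy `j`, corrected by the difference of the
  -- rotations. That difference is less than `n`, so `r + n ≤ 2 ^ n` keeps the window inside the
  -- copy.
  let q : ℕ → ℕ := fun j' => r - L + (j / t - j' / t)
  have hq : ∀ j', q j' + L + 1 ≤ 2 ^ n := fun j' => by
    have := Nat.sub_le (j / t) (j' / t)
    simp only [q]
    omega
  have hwin : ∀ j' ≤ j, win S (start n + j' * 2 ^ n + q j') (L + 1) = u ++ [S i] := by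
    have base : ∀ j' ≤ j, win S (start n + j' * 2 ^ n + q j') (L + 1) =
        win (D n) (r - L + j / t) (L + 1) := by
      intro j' hj'
      have := hdiv j' hj'
      rw [h.win_copy hn (by omega) (by have := hq j'; omega)]
      congr 1
      simp only [q, t] at this ⊢
      omega
    intro j' hj'
    rw [base j' hj', ← base j le_rfl, hub]
    congr 1
    simp only [q]
    omega
  have hlt : ∀ j' < j, start n + j' * 2 ^ n + q j' + (L + 1) ≤ start n + j * 2 ^ n := by
    intro j' hj'
    have h1 := hq j'
    have h2 : (j' + 1) * 2 ^ n ≤ j * 2 ^ n := Nat.mul_le_mul_right _ hj'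
    rw [Nat.succ_mul] at h2
    omega
  have hinj : ∀ a b, start n + a * 2 ^ n + q a = start n + b * 2 ^ n + q b → a = b := by
    intro a b hab
    have ha := hq a
    have hb := hq b
    have e : q a + 2 ^ n * a = q b + 2 ^ n * b := by linarith
    have := congrArg (· / 2 ^ n) e
    simpa [Nat.add_mul_div_left, Nat.div_eq_of_lt (show q a < 2 ^ n by omega),
      Nat.div_eq_of_lt (show q b < 2 ^ n by omega)] using this
  have hcnt : j ≤ cnt (pref S i) u (S i) := by
    rw [cnt, occ_pref, List.length_append, List.length_singleton, hul]
    have : #(range j) = j := card_range j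
    rw [← this]
    refine card_le_card_of_injOn (fun j' => start n + j' * 2 ^ n + q j') ?_
      fun a _ b _ hab => hinj a b hab
    intro j' hj'
    have hj'' : j' < j := by simpa using hj'
    have h1 := hlt j' hj''
    simp only [coe_filter, mem_range, Set.mem_ofPred_eq]
    exact ⟨by omega, by omega, hwin j' hj''.le⟩
  have hnext : start (n + 1) = start n + n * 2 ^ n := start_succ n
  have hiN : i < start (n + 1) := by
    have : (j + 1) * 2 ^ n ≤ n * 2 ^ n := Nat.mul_le_mul_right _ hj
    rw [Nat.succ_mul] at this
    omega
  have hzero : cnt (pref S i) u (!S i) = 0 := by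
    by_contra hne
    obtain ⟨p, hp⟩ := card_pos.1 (Nat.pos_of_ne_zero (by rwa [cnt, occ_pref] at hne))
    simp only [List.length_append, List.length_singleton, hul, mem_filter, mem_range] at hp
    refine hu (mem_filter.2 ⟨mem_windows.2 ⟨i - L, by omega, rfl⟩, fun b => ?_⟩)
    by_cases hb : b = S i
    · rw [hb]
      exact mem_windows.2 ⟨i - L, by omega, hub.symm⟩
    · rw [Bool.eq_not_of_ne hb]
      exact mem_windows.2 ⟨p, by omega, hp.2.2⟩
  have hesc : esc (pref S i) u = 1 := by
    unfold esc
    revert hcnt hzero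
    cases S i <;> intro hcnt hzero
    · rw [Bool.not_false] at hzero
      rw [if_pos (by omega), if_neg (by omega)]
    · rw [Bool.not_true] at hzero
      rw [if_neg (by omega), if_pos (by omega)]
  have hm : InModel (pref S i) u := by
    refine ⟨Or.inr (le_trans ?_ (occ_le_of_prefix (List.dropLast_prefix u) _)), ?_⟩
    · rw [occ_pref, hul]
      -- The two occurrences are the one in copy `0` and the one that ends the text read so far.
      refine one_lt_card.2 ⟨start n + 0 * 2 ^ n + q 0, ?_, i - L, ?_, ?_⟩
      · have h1 := hlt 0 hj1
        have h2 := hwin 0 (Nat.zero_le _)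
        rw [win_succ] at h2
        exact mem_filter.2 ⟨mem_range.2 (by omega), by omega, (List.append_inj h2 (by simp [hul])).1⟩
      · exact mem_filter.2 ⟨mem_range.2 (by omega), by omega, rfl⟩
      · have := hlt 0 hj1
        omega
    · revert hcnt
      cases S i <;> intro hcnt <;> omega
  have key := bitProb_ge_of_deterministic hj1 (win_suffix_pref S (by omega)) hm hesc hcnt
  have hj0 : (0 : ℚ) < j := by exact_mod_cast hj1
  refine (cost_le (by positivity) key).trans (le_of_eq ?_)
  have hj0' : (j : ℝ) ≠ 0 := by positivity
  push_cast
  rw [Real.logb_div hj0' (by positivity)]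
  ring

/-- The total cost of a copy that is not the first one of its zone. -/
lemma cost_copy_le (h : IsZoned S D) {n j L : ℕ} (hn : 3 ≤ n) (hj1 : 1 ≤ j) (hj : j < n)
    (hnL : n ≤ L) :
    ∑ r ∈ range (2 ^ n), cost S (start n + j * 2 ^ n + r) ≤
      2 ^ n * (Real.logb 2 (j + 1 : ℕ) - Real.logb 2 j) +
        (L + n + #(rightSpecial S (start (n + 1)) L)) * maxCost n := by
  set R := rightSpecial S (start (n + 1)) L
  set δ := Real.logb 2 (j + 1 : ℕ) - Real.logb 2 j with hδ
  have hδ0 : 0 ≤ δ := by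
    rw [hδ, sub_nonneg]
    refine Real.logb_le_logb_of_le (by norm_num) (by exact_mod_cast hj1) ?_
    push_cast
    linarith
  -- The exceptional positions: the context would reach back before the copy, the shifted windows
  -- might not fit into earlier copies, or the context is right special.
  let B : Finset ℕ := {r ∈ range (2 ^ n) | r < L ∨ 2 ^ n < r + n ∨
    win S (start n + j * 2 ^ n + r - L) L ∈ R}
  have hB : #B ≤ L + n + #R := by
    have hsub : B ⊆ range L ∪ Ico (2 ^ n - n) (2 ^ n) ∪
        {r ∈ Ico L (2 ^ n) | win S (start n + j * 2 ^ n + r - L) L ∈ R} := by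
      intro r hr
      simp only [B, mem_filter, mem_range, mem_union, mem_Ico] at hr ⊢
      by_cases h1 : r < L
      · exact Or.inl (Or.inl h1)
      rcases hr.2 with h2 | h2 | h2
      · exact absurd h2 h1
      · exact Or.inl (Or.inr ⟨by omega, hr.1⟩)
      · exact Or.inr ⟨⟨by omega, hr.1⟩, h2⟩
    refine (card_le_card hsub).trans ((card_union_le _ _).trans (Nat.add_le_add
      ((card_union_le _ _).trans (Nat.add_le_add (by simp) ?_)) ?_))
    · rw [Nat.card_Ico]; omega
    -- Since `n ≤ L`, a right special window occurs at most once inside the copy.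
    · refine card_le_card_of_injOn (fun r => win S (start n + j * 2 ^ n + r - L) L)
        (fun r hr => (mem_filter.1 hr).2) ?_
      intro a ha b hb hab
      simp only [coe_filter, mem_Ico, Set.mem_ofPred_eq] at ha hb
      simp only at hab
      rw [Nat.add_sub_assoc ha.1.1, Nat.add_sub_assoc hb.1.1,
        h.win_copy (by omega) hj (by omega), h.win_copy (by omega) hj (by omega)] at hab
      have h1 := Nat.ModEq.add_left_cancel' _ (h.modEq_of_win_eq (by omega) hnL hab)
      have := Nat.ModEq.eq_of_lt_of_lt h1 (by omega) (by omega)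
      omega
  have hpt : ∀ r ∈ range (2 ^ n), cost S (start n + j * 2 ^ n + r) ≤
      δ + if r ∈ B then maxCost n else 0 := by
    intro r hr
    split_ifs with hrB
    · have hr' := mem_range.1 hr
      have h1 : (j + 1) * 2 ^ n ≤ n * 2 ^ n := Nat.mul_le_mul_right _ hj
      rw [Nat.succ_mul] at h1
      have := h.cost_le_maxCost (i := start n + j * 2 ^ n + r) hn (by omega)
        (by rw [start_succ]; omega)
      linarith
    · simp only [B, mem_filter, hr, true_and, not_or, not_lt] at hrB
      rw [add_zero]
      exact h.cost_le_of_not_mem_rightSpecial (by omega) hj1 hj (by omega) hrB.1 hrB.2.1 hrB.2.2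
  refine (sum_le_sum hpt).trans ?_
  rw [sum_add_distrib, sum_const, card_range, nsmul_eq_mul, ← sum_filter, sum_const, nsmul_eq_mul]
  have hBr : (#{r ∈ range (2 ^ n) | r ∈ B} : ℝ) ≤ L + n + #R := by
    have : #{r ∈ range (2 ^ n) | r ∈ B} ≤ #B :=
      card_le_card fun r hr => (mem_filter.1 hr).2
    exact_mod_cast this.trans hB
  push_cast
  exact add_le_add_right (mul_le_mul_of_nonneg_right hBr (maxCost_nonneg n)) _

/-- In units of `2 ^ n * maxCost n`, the first copy contributes 1, the telescoping sum of logarithms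
at most 1, and the right special contexts of all copies 2, because `n` times their number is at most
the number of windows of length `2 * n`. The cubic term collects boundary effects: `3 * n ^ 2 + 2 *
n * (n + 1) ^ 2 ≤ 11 * n ^ 3`. -/
lemma cost_zone_le (h : IsZoned S D) {n : ℕ} (hn : 3 ≤ n) :
    ∑ j ∈ range n, ∑ r ∈ range (2 ^ n), cost S (start n + j * 2 ^ n + r) ≤
      (4 * 2 ^ n + 11 * (n : ℝ) ^ 3) * maxCost n := by
  obtain ⟨L, hL1, hL2, hL3⟩ := exists_rightSpecial_card_le S (start (n + 1)) (show 1 ≤ n by omega)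
  have hW := hL3.trans (h.card_windows_le n (2 * n))
  set R := #(rightSpecial S (start (n + 1)) L) with hR
  have hG := maxCost_nonneg n
  obtain ⟨k, rfl⟩ := Nat.exists_eq_add_of_le' (show 1 ≤ n by omega)
  set n := k + 1 with hk
  have hfirst : ∑ r ∈ range (2 ^ n), cost S (start n + 0 * 2 ^ n + r) ≤ 2 ^ n * maxCost n := by
    have : ∀ r ∈ range (2 ^ n), cost S (start n + 0 * 2 ^ n + r) ≤ maxCost n := by
      intro r hr
      have hr' := mem_range.1 hr
      refine h.cost_le_maxCost hn (by omega) ?_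
      rw [start_succ n]
      nlinarith
    refine (sum_le_card_nsmul _ _ _ this).trans (le_of_eq ?_)
    rw [card_range, nsmul_eq_mul]
    push_cast
    ring
  have hlog : Real.logb 2 n ≤ maxCost n := by
    have hn0 : (0 : ℝ) < n := by positivity
    have h1 : Real.logb 2 n ≤ Real.logb 2 (2 * (n + 2) ^ 3 + 2) := by
      refine Real.logb_le_logb_of_le (by norm_num) hn0 ?_
      nlinarith [pow_pos hn0 2, pow_pos hn0 3]
    have h2 : 0 ≤ Real.logb 2 (2 * ((n : ℕ) + 2 : ℝ) ^ 3 + 2) := by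
      unfold maxCost at hG; linarith
    unfold maxCost
    linarith
  have hrest : ∑ j ∈ range k, ∑ r ∈ range (2 ^ n), cost S (start n + (j + 1) * 2 ^ n + r) ≤
      2 ^ n * Real.logb 2 n + k * ((L + n + R) * maxCost n) := by
    calc _ ≤ ∑ j ∈ range k, (2 ^ n * (Real.logb 2 (j + 1 + 1 : ℕ) - Real.logb 2 (j + 1 : ℕ)) +
          (L + n + R) * maxCost n) := sum_le_sum fun j hj =>
            h.cost_copy_le hn (by omega) (by have := mem_range.1 hj; omega) hL1
      _ = _ := by
        rw [sum_add_distrib, ← mul_sum,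
          sum_range_sub (fun j : ℕ => Real.logb 2 (j + 1 : ℕ)), sum_const, card_range, nsmul_eq_mul]
        simp [hk]
  rw [hk, sum_range_succ', ← hk]
  have hWr : (n : ℝ) * R ≤ 2 ^ (n + 1) + (n + 1) ^ 2 * (2 * n) := by exact_mod_cast hW
  have hL2r : (L : ℝ) ≤ 2 * n := by exact_mod_cast hL2
  have hkn : (k : ℝ) ≤ n := by rw [hk]; push_cast; linarith
  have hn1 : (1 : ℝ) ≤ n := by exact_mod_cast (by omega : 1 ≤ n)
  have hR0 : (0 : ℝ) ≤ R := by positivity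
  have hpoly : (k : ℝ) * (L + n + R) ≤ 2 * 2 ^ n + 11 * (n : ℝ) ^ 3 := by
    calc (k : ℝ) * (L + n + R) ≤ n * (2 * n + n + R) := by gcongr
      _ = 3 * (n : ℝ) ^ 2 + n * R := by ring
      _ ≤ 3 * (n : ℝ) ^ 2 + (2 ^ (n + 1) + (n + 1) ^ 2 * (2 * n)) := by linarith
      _ ≤ _ := by
        have h2 : (n : ℝ) ≤ n ^ 2 := by nlinarith
        have h3 : (n : ℝ) ^ 2 ≤ n ^ 3 := by nlinarith [sq_nonneg (n : ℝ)]
        rw [pow_succ (2 : ℝ)]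
        nlinarith
  have hp : (0 : ℝ) ≤ 2 ^ n := by positivity
  have h5 := mul_le_mul_of_nonneg_right hpoly hG
  have h6 := mul_le_mul_of_nonneg_left hlog hp
  nlinarith

end IsZoned

end PPMLZ

namespace PPMLZ

open Finset Filter Asymptotics Topology

/-! ### The PPM* ratio of a zoned sequence -/

lemma maxCost_isLittleO : maxCost =o[atTop] fun n : ℕ => (n : ℝ) := by
  have h1 : (fun n : ℕ => 10 / Real.log 2 * Real.log n) =o[atTop] fun n : ℕ => (n : ℝ) :=
    (Real.isLittleO_log_id_atTop.comp_tendsto tendsto_natCast_atTop_atTop).const_mul_left _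
  refine IsBigO.trans_isLittleO (IsBigO.of_bound 1 ?_) h1
  filter_upwards [eventually_ge_atTop 4] with n hn
  have hn' : (4 : ℝ) ≤ n := by exact_mod_cast hn
  have hl2 : 0 < Real.log 2 := Real.log_pos (by norm_num)
  have hln : 0 ≤ Real.log n := Real.log_nonneg (by linarith)
  rw [Real.norm_of_nonneg (maxCost_nonneg n), Real.norm_of_nonneg (by positivity), one_mul]
  have hle : 2 * ((n : ℝ) + 2) ^ 3 + 2 ≤ n ^ 5 := by
    have a1 : ((n : ℝ) + 2) ^ 3 ≤ (3 / 2 * n) ^ 3 := by gcongr; linarith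
    have a2 : (64 : ℝ) ≤ n ^ 3 := by
      calc (64 : ℝ) = 4 ^ 3 := by norm_num
        _ ≤ n ^ 3 := by gcongr
    have a3 : (16 : ℝ) * n ^ 3 ≤ n ^ 5 := by
      have : (4 : ℝ) ^ 2 ≤ n ^ 2 := by gcongr
      nlinarith
    nlinarith
  have h2 : Real.logb 2 (2 * ((n : ℝ) + 2) ^ 3 + 2) ≤ 5 * (Real.log n / Real.log 2) := by
    refine (Real.logb_le_logb_of_le (by norm_num) (by positivity) hle).trans (le_of_eq ?_)
    rw [Real.logb_pow, Real.logb]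
    norm_num
  unfold maxCost
  calc _ ≤ 2 * (5 * (Real.log n / Real.log 2)) := by linarith
    _ = _ := by ring

namespace IsZoned

variable {S : ℕ → Bool} {D : ℕ → ℕ → Bool}

/-- A zone costs `O(2 ^ n)` times `maxCost n`, which is `o(n)`. As costs are nonnegative, the cost
of the whole zone also bounds that of each initial part. -/
lemma tendsto_average_cost (h : IsZoned S D) :
    Tendsto (fun m : ℕ => (∑ i ∈ range m, cost S i) / m) atTop (𝓝 0) := by
  let E : ℕ → ℝ := fun n => ∑ i ∈ range (n * 2 ^ n), cost S (start n + i)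
  have hEeq : ∀ n, E n = ∑ j ∈ range n, ∑ r ∈ range (2 ^ n), cost S (start n + j * 2 ^ n + r) := by
    intro n
    have h1 := sum_range_start (cost S) (n + 1)
    rw [start_succ, sum_range_add, sum_range_succ, sum_range_start (cost S) n] at h1
    exact add_left_cancel h1
  have hE0 : ∀ n, 0 ≤ E n := fun n => sum_nonneg fun i _ => cost_nonneg _ _
  refine tendsto_average_zero (E := E) ?_ fun n r hr => ?_
  · have h3 : (fun n : ℕ => 4 * (2 : ℝ) ^ n + 11 * (n : ℝ) ^ 3) =O[atTop] fun n : ℕ => (2 : ℝ) ^ n :=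
      ((isBigO_refl _ _).const_mul_left _).add
        ((isLittleO_pow_const_const_pow_of_one_lt 3 (by norm_num)).isBigO.const_mul_left _)
    have h4 := h3.mul_isLittleO maxCost_isLittleO
    simp only [mul_comm ((2 : ℝ) ^ _)] at h4
    refine IsBigO.trans_isLittleO (IsBigO.of_bound 1 ?_) h4
    filter_upwards [eventually_ge_atTop 3] with n hn
    rw [Real.norm_of_nonneg (hE0 n), one_mul, hEeq]
    refine (h.cost_zone_le hn).trans (le_trans (le_of_eq ?_) (le_abs_self _))
    ring
  · rw [abs_of_nonneg (sum_nonneg fun i _ => cost_nonneg _ _)]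
    exact sum_le_sum_of_subset_of_nonneg (range_subset_range.2 hr) fun i _ _ => cost_nonneg _ _

theorem worstRatio_ppmStar (h : IsZoned S D) : worstRatio ppmStar S = 0 := by
  have h1 : Tendsto (fun m : ℕ => (∑ i ∈ range m, cost S i) / m + 2 / m) atTop (𝓝 0) := by
    simpa using h.tendsto_average_cost.add (tendsto_const_div_atTop_nhds_zero_nat 2)
  have h2 : Tendsto (fun m : ℕ => ((ppmStar (pref S m)).length : ℝ) / m) atTop (𝓝 0) := by
    refine squeeze_zero (fun m => by positivity) (fun m => ?_) h1
    rw [← add_div]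
    exact div_le_div_of_nonneg_right (length_ppmStar_pref_le S m) (by positivity)
  exact ((continuous_coe_real_ereal.tendsto 0).comp h2).limsup_eq

end IsZoned

end PPMLZ

theorem theorem4 :
    ∃ (db : ℕ → List Bool) (S : ℕ → Bool),
      (∀ n : ℕ, 1 ≤ n → IsLeast {x : List Bool | PPMLZ.IsDeBruijn n x} (db n)) ∧
      PPMLZ.IsZoneSequence db S ∧
      PPMLZ.IsNormal S ∧
      PPMLZ.worstRatio PPMLZ.ppmStar S = 0 ∧
      ∀ c : ℕ → List Bool, PPMLZ.IsPointerCode c → PPMLZ.bestRatio (PPMLZ.lz c) S = 1 := by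
  have hex : ∀ n : ℕ, ∃ d, 1 ≤ n → IsLeast {x : List Bool | PPMLZ.IsDeBruijn n x} d := by
    intro n
    by_cases hn : 1 ≤ n
    · obtain ⟨d, hd⟩ := PPMLZ.exists_isLeast_isDeBruijn hn
      exact ⟨d, fun _ => hd⟩
    -- An arbitrary value at order `0`, which no zone uses.
    · exact ⟨[], fun h => absurd h hn⟩
  choose db hdb using hex
  have hdeb : ∀ n, 1 ≤ n → PPMLZ.IsDeBruijn n (db n) := fun n hn => (hdb n hn).1
  obtain ⟨S, hS⟩ := PPMLZ.exists_isZoneSequence fun n hn => (hdeb n hn).1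
  have h := PPMLZ.isZoned hdeb hS
  exact ⟨db, S, hdb, hS, h.isNormal, h.worstRatio_ppmStar, fun c hc => h.bestRatio_lz hc⟩
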